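/- Let $N\ge 1$ and let $\mathbf a=(a_1,\dots,a_n)$, $\mathbf b=(b_1,\dots,b_m)$ be compositions of $N$ (ordered lists of positive integers with sum $N$), dividing $\{1,\dots,N\}$ into consecutive blocks $A_1,\dots,A_n$ with $|A_i|=a_i$ and $B_1,\dots,B_m$ with $|B_i|=b_i$, respectively. The seaweed algebra $\mathfrak s=\mathfrak p\frac{\mathbf a}{\mathbf b}\subseteq\mathfrak{gl}(N,\mathbb C)$ is the Lie subalgebra spanned by all matrix units $E_{j,j}$, all $E_{p,q}$ with $p>q$ in a common block $A_i$, and all $E_{p,q}$ with $p<q$ in a common block $B_i$. The type-A seaweed algebra $\mathfrak s^A=\mathfrak p^A\frac{\mathbf a}{\mathbf b}\subseteq\mathfrak{sl}(N,\mathbb C)$ is the subalgebra of trace-zero elements of $\mathfrak s$. The meander $\mathrm M$ of $\mathfrak s$ (and of $\mathfrak s^A$) is the multigraph on $v_1,\dots,v_N$ in which, for each block $A_i$ and each $t$, a top edge joins the $t$-th vertex of the block to the $t$-th vertex from its end whenever these are distinct (one edge per such pair), and bottom edges are defined in the same way from the blocks $B_i$. Let $\mathrm E_1$ be the set of edges of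 $\mathrm M$ for which no other edge of $\mathrm M$ connects the same two vertices. Let $\lambda_1<\dots<\lambda_\ell$ be the common elements of the sets of partial sums $\{a_1+\dots+a_j : 1\le j\le n\}$ and $\{b_1+\dots+b_j : 1\le j\le m\}$, put $\lambda_0=0$, and let $\mathrm{Cen}$ be the set of central components of $\mathrm M$, i.e. of the subgraphs induced by $\{v_i:\lambda_{j-1}<i\le\lambda_j\}$, $1\le j\le\ell$. For a finite-dimensional complex Lie algebra $\mathfrak g$, let $\mathfrak n(\mathfrak g)$ denote its nilradical (its largest nilpotent ideal), and let $\operatorname{ind}\mathfrak g=\min_{F\in\mathfrak g^*}\dim\{x\in\mathfrak g: F([x,y])=0\text{ for all }y\in\mathfrak g\}$ be its index. Then $$\operatorname{ind}\mathfrak n(\mathfrak s)\ \ge\ |\mathrm E_1|+|\mathrm{Cen}|\qquad\text{and}\qquad \operatorname{ind}\mathfrak n(\mathfrak s^A)\ \ge\ |\mathrm E_1|+|\mathrm{Cen}|-1 .$$ -/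

import Mathlib

-- Square matrices carry the commutator bracket `⁅X, Y⁆ = X * Y - Y * X`.
attribute [local instance] LieRing.ofAssociativeRing

noncomputable section

/-- The index of a (finite-dimensional) Lie algebra over a field: the minimum over all linear
functionals `F` of the dimension of the kernel `{x | ∀ y, F ⁅x, y⁆ = 0}` of the form `F ⁅·, ·⁆`. -/
def lieIndex (K L : Type*) [Field K] [LieRing L] [LieAlgebra K L] : ℕ :=
  sInf {d | ∃ F : Module.Dual K L, d = Module.finrank K
    (LinearMap.ker ((LieModule.toEnd K L L : L →ₗ[K] Module.End K L).compr₂ F))}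

theorem mem_ker_bracketForm {K L : Type*} [Field K] [LieRing L] [LieAlgebra K L]
    (F : Module.Dual K L) (x : L) :
    x ∈ LinearMap.ker ((LieModule.toEnd K L L : L →ₗ[K] Module.End K L).compr₂ F) ↔
      ∀ y : L, F ⁅x, y⁆ = 0 := by
  simp [LinearMap.ext_iff]

/-- The nilradical: the largest ideal that is nilpotent as a Lie algebra. (Mathlib's
`LieAlgebra.maxNilpotentIdeal` is a different ideal: the largest one that is nilpotent as a
*module over the whole Lie algebra*.) -/
def lieNilradical (K L : Type*) [Field K] [LieRing L] [LieAlgebra K L] : LieIdeal K L :=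
  sSup {I : LieIdeal K L | LieRing.IsNilpotent I}

/-- The positions `(p, q)` such that the matrix unit `E_{p,q}` lies in the seaweed algebra of the
compositions `a` (top) and `b` (bottom). `c.index p` is the number of the block containing `p`. -/
def SeaweedPos {N : ℕ} (a b : Composition N) (p q : Fin N) : Prop :=
  p = q ∨ (q < p ∧ a.index p = a.index q) ∨ (p < q ∧ b.index p = b.index q)

/-- The vector space underlying the seaweed algebra: the span of the matrix units `E_{j,j}`, the
`E_{p,q}` with `p > q` in one block of `a`, and the `E_{p,q}` with `p < q` in one block of `b`. -/
def seaweedSpan {N : ℕ} (a b : Composition N) : Submodule ℂ (Matrix (Fin N) (Fin N) ℂ) :=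
  Submodule.span ℂ
    ({X | ∃ j, X = Matrix.single j j 1} ∪
      {X | ∃ p q, q < p ∧ a.index p = a.index q ∧ X = Matrix.single p q 1} ∪
      {X | ∃ p q, p < q ∧ b.index p = b.index q ∧ X = Matrix.single p q 1})

theorem mem_seaweedSpan {N : ℕ} {a b : Composition N} {X : Matrix (Fin N) (Fin N) ℂ} :
    X ∈ seaweedSpan a b ↔ ∀ p q, ¬ SeaweedPos a b p q → X p q = 0 := by
  constructor
  · intro hX p q hpq
    unfold seaweedSpan at hX
    induction hX using Submodule.span_induction with
    | mem Y hY =>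
      simp only [SeaweedPos, not_or] at hpq
      rcases hY with (⟨j, rfl⟩ | ⟨r, s, h, h', rfl⟩) | ⟨r, s, h, h', rfl⟩ <;>
      · rw [Matrix.single_apply, if_neg]
        rintro ⟨rfl, rfl⟩
        tauto
    | zero => rfl
    | add Y Z _ _ hY hZ => simp [hY, hZ]
    | smul c Y _ hY => simp [hY]
  · intro h
    rw [Matrix.matrix_eq_sum_single X]
    refine Submodule.sum_mem _ fun p _ => Submodule.sum_mem _ fun q _ => ?_
    by_cases hpq : SeaweedPos a b p q
    · have hs : Matrix.single p q (X p q) = X p q • Matrix.single p q (1 : ℂ) := by simp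
      rw [hs]
      refine Submodule.smul_mem _ _ (Submodule.subset_span ?_)
      rcases hpq with rfl | ⟨h1, h2⟩ | ⟨h1, h2⟩
      · exact Or.inl (Or.inl ⟨p, rfl⟩)
      · exact Or.inl (Or.inr ⟨p, q, h1, h2, rfl⟩)
      · exact Or.inr ⟨p, q, h1, h2, rfl⟩
    · rw [h p q hpq, Matrix.single_zero]
      exact Submodule.zero_mem _

theorem Composition.index_mono_aux {N : ℕ} (c : Composition N) {p q : Fin N} (h : p ≤ q) :
    c.index p ≤ c.index q := by
  by_contra hlt
  push Not at hlt
  have h1 := c.lt_sizeUpTo_index_succ q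
  have h2 := c.sizeUpTo_index_le p
  have h3 : c.sizeUpTo (c.index q).succ ≤ c.sizeUpTo (c.index p) := by
    apply c.monotone_sizeUpTo
    simp only [Fin.val_succ]
    exact hlt
  have h4 : (p : ℕ) ≤ q := h
  omega

theorem SeaweedPos.trans {N : ℕ} {a b : Composition N} {p q r : Fin N}
    (h : SeaweedPos a b p q) (h' : SeaweedPos a b q r) : SeaweedPos a b p r := by
  have key : ∀ (c : Composition N) {x y z : Fin N}, x ≤ y → y ≤ z →
      c.index x = c.index z → c.index x = c.index y ∧ c.index y = c.index z := by
    intro c x y z hxy hyz hxz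
    have h1 := c.index_mono_aux hxy
    have h2 := c.index_mono_aux hyz
    rw [← hxz] at h2
    have h3 := le_antisymm h1 h2
    exact ⟨h3, h3.symm.trans hxz⟩
  rcases h with rfl | ⟨h1, h2⟩ | ⟨h1, h2⟩
  · exact h'
  · rcases h' with rfl | ⟨h3, h4⟩ | ⟨h3, h4⟩
    · exact Or.inr (Or.inl ⟨h1, h2⟩)
    · exact Or.inr (Or.inl ⟨h3.trans h1, h2.trans h4⟩)
    · rcases lt_trichotomy p r with h5 | rfl | h5
      · exact Or.inr (Or.inr ⟨h5, (key b h1.le h5.le h4).2⟩)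
      · exact Or.inl rfl
      · exact Or.inr (Or.inl ⟨h5, ((key a h3.le h5.le h2.symm).2).symm⟩)
  · rcases h' with rfl | ⟨h3, h4⟩ | ⟨h3, h4⟩
    · exact Or.inr (Or.inr ⟨h1, h2⟩)
    · rcases lt_trichotomy p r with h5 | rfl | h5
      · exact Or.inr (Or.inr ⟨h5, (key b h5.le h3.le h2).1⟩)
      · exact Or.inl rfl
      · exact Or.inr (Or.inl ⟨h5, ((key a h5.le h1.le h4.symm).1).symm⟩)
    · exact Or.inr (Or.inr ⟨h1.trans h3, h2.trans h4⟩)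

/-- The seaweed algebra, a Lie subalgebra of `gl(N, ℂ)`. -/
def seaweed {N : ℕ} (a b : Composition N) : LieSubalgebra ℂ (Matrix (Fin N) (Fin N) ℂ) where
  toSubmodule := seaweedSpan a b
  lie_mem' := by
    have hmul : ∀ X Y : Matrix (Fin N) (Fin N) ℂ, X ∈ seaweedSpan a b → Y ∈ seaweedSpan a b →
        X * Y ∈ seaweedSpan a b := by
      intro X Y hX hY
      rw [mem_seaweedSpan] at *
      intro p q hpq
      rw [Matrix.mul_apply]
      refine Finset.sum_eq_zero fun r _ => ?_
      by_cases h1 : SeaweedPos a b p r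
      · rw [hY r q fun h2 => hpq (h1.trans h2), mul_zero]
      · rw [hX p r h1, zero_mul]
    intro X Y hX hY
    change X * Y - Y * X ∈ seaweedSpan a b
    exact (seaweedSpan a b).sub_mem (hmul X Y hX hY) (hmul Y X hY hX)

theorem mem_seaweed {N : ℕ} {a b : Composition N} {X : Matrix (Fin N) (Fin N) ℂ} :
    X ∈ seaweed a b ↔ ∀ p q, ¬ SeaweedPos a b p q → X p q = 0 :=
  mem_seaweedSpan

/-- The type-A seaweed algebra, a Lie subalgebra of `sl(N, ℂ)`: the elements of the seaweed algebra
of trace zero. -/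
def seaweedA {N : ℕ} (a b : Composition N) :
    LieSubalgebra ℂ (LieAlgebra.SpecialLinear.sl (Fin N) ℂ) :=
  (seaweed a b).comap (LieAlgebra.SpecialLinear.sl (Fin N) ℂ).incl

/-- The type-A seaweed algebra is spanned by the `E_{1,1} - E_{j,j}` with `j ≠ 1`, the `E_{p,q}`
with `p > q` in one block of `a`, and the `E_{p,q}` with `p < q` in one block of `b`. -/
theorem seaweedA_toSubmodule_eq_span {N : ℕ} [NeZero N] (a b : Composition N) :
    (seaweedA a b).toSubmodule = Submodule.span ℂ
      ({X | ∃ j, j ≠ 0 ∧ X.1 = Matrix.single 0 0 1 - Matrix.single j j 1} ∪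
        {X | ∃ p q, q < p ∧ a.index p = a.index q ∧ X.1 = Matrix.single p q 1} ∪
        {X | ∃ p q, p < q ∧ b.index p = b.index q ∧ X.1 = Matrix.single p q 1}) := by
  have htr : ∀ {Y : Matrix (Fin N) (Fin N) ℂ},
      Y ∈ LieAlgebra.SpecialLinear.sl (Fin N) ℂ ↔ Matrix.trace Y = 0 := fun {Y} => by
    change Y ∈ LinearMap.ker (Matrix.traceLinearMap (Fin N) ℂ ℂ) ↔ _
    rw [LinearMap.mem_ker, Matrix.traceLinearMap_apply]
  apply le_antisymm
  · intro X hX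
    replace hX : ∀ p q, ¬ SeaweedPos a b p q → X.1 p q = 0 := mem_seaweed.1 hX
    have ht : ∑ p, X.1 p p = 0 := htr.1 X.2
    have hoff : ∀ p q : Fin N, Matrix.trace
        (if p = q then Matrix.single p p 1 - Matrix.single 0 0 1
          else Matrix.single p q (1 : ℂ)) = 0 := by
      intro p q
      split_ifs with h
      · simp [Matrix.trace_sub]
      · exact Matrix.trace_single_eq_of_ne p q 1 h
    have hX' : X = ∑ p, ∑ q, X.1 p q •
        (⟨_, htr.2 (hoff p q)⟩ : LieAlgebra.SpecialLinear.sl (Fin N) ℂ) := by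
      apply Subtype.ext
      have hc : ∀ f : Fin N → Fin N → LieAlgebra.SpecialLinear.sl (Fin N) ℂ,
          (∑ p, ∑ q, X.1 p q • f p q).1 = ∑ p, ∑ q, X.1 p q • (f p q).1 := by
        intro f
        simp
      rw [hc]
      have : ∀ p, ∑ q, X.1 p q • (if p = q then Matrix.single p p 1 - Matrix.single 0 0 1
          else Matrix.single p q (1 : ℂ)) =
          ∑ q, Matrix.single p q (X.1 p q) - X.1 p p • Matrix.single 0 0 1 := by
        intro p
        rw [eq_sub_iff_add_eq]
        have h2 : X.1 p p • Matrix.single 0 0 (1 : ℂ) =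
            ∑ q, if p = q then X.1 p q • Matrix.single (0 : Fin N) (0 : Fin N) (1 : ℂ) else 0 := by
          simp
        rw [h2, ← Finset.sum_add_distrib]
        refine Finset.sum_congr rfl fun q _ => ?_
        split_ifs with h
        · subst h
          rw [smul_sub, sub_add_cancel]
          simp
        · simp
      simp only [this]
      rw [Finset.sum_sub_distrib, ← Finset.sum_smul, ht, zero_smul, sub_zero]
      exact Matrix.matrix_eq_sum_single X.1
    rw [hX']
    refine Submodule.sum_mem _ fun p _ => Submodule.sum_mem _ fun q _ => ?_
    by_cases hpq : SeaweedPos a b p q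
    · refine Submodule.smul_mem _ _ ?_
      by_cases h : p = q
      · subst h
        by_cases h0 : p = 0
        · convert Submodule.zero_mem _
          simp [h0]
        · rw [← Submodule.neg_mem_iff]
          refine Submodule.subset_span (Or.inl (Or.inl ⟨p, h0, ?_⟩))
          simp
      · apply Submodule.subset_span
        rcases hpq with rfl | ⟨h1, h2⟩ | ⟨h1, h2⟩
        · exact absurd rfl h
        · exact Or.inl (Or.inr ⟨p, q, h1, h2, by simp [h]⟩)
        · exact Or.inr ⟨p, q, h1, h2, by simp [h]⟩
    · rw [hX p q hpq, zero_smul]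
      exact Submodule.zero_mem _
  · rw [Submodule.span_le]
    intro X hX
    change X.1 ∈ seaweedSpan a b
    rcases hX with (⟨j, _, h⟩ | ⟨p, q, h1, h2, h⟩) | ⟨p, q, h1, h2, h⟩ <;> rw [h]
    · exact Submodule.sub_mem _ (Submodule.subset_span (Or.inl (Or.inl ⟨0, rfl⟩)))
        (Submodule.subset_span (Or.inl (Or.inl ⟨j, rfl⟩)))
    · exact Submodule.subset_span (Or.inl (Or.inr ⟨p, q, h1, h2, rfl⟩))
    · exact Submodule.subset_span (Or.inr ⟨p, q, h1, h2, rfl⟩)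

/-- The arcs of a composition: within each block, the `t`-th vertex is joined to the `t`-th vertex
from the end, provided that the two are distinct. -/
def blockArcs {N : ℕ} (c : Composition N) : Set (Sym2 (Fin N)) :=
  {e | ∃ (k : Fin c.length) (t : Fin (c.blocksFun k)),
    t ≠ t.rev ∧ e = s(c.embedding k t, c.embedding k t.rev)}

/-- The meander as a multigraph on `Fin N`. Its top edges are the `Sum.inl e` with `e` an arc of
`a`, its bottom edges are the `Sum.inr e` with `e` an arc of `b`. -/
def meander {N : ℕ} (a b : Composition N) : Graph (Fin N) (Sym2 (Fin N) ⊕ Sym2 (Fin N)) where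
  vertexSet := Set.univ
  IsLink e x y := (e = Sum.inl s(x, y) ∧ s(x, y) ∈ blockArcs a) ∨
    (e = Sum.inr s(x, y) ∧ s(x, y) ∈ blockArcs b)
  isLink_symm e _ := ⟨fun x y h => by rwa [Sym2.eq_swap]⟩
  eq_or_eq_of_isLink_of_isLink := by
    rintro e x y v w (⟨rfl, -⟩ | ⟨rfl, -⟩) (⟨h, -⟩ | ⟨h, -⟩) <;> simp at h <;> tauto
  left_mem_of_isLink := fun _ _ _ _ => Set.mem_univ _

/-- The edges of the meander for which no other edge connects the same two vertices. -/
def nonparallelEdges {N : ℕ} (a b : Composition N) : Set (Sym2 (Fin N) ⊕ Sym2 (Fin N)) :=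
  {e | ∃ x y, (meander a b).IsLink e x y ∧ ∀ e', (meander a b).IsLink e' x y → e' = e}

/-- The set of partial sums `c₁ + ⋯ + c_j`, `1 ≤ j ≤ n`, of a composition `c = (c₁, …, c_n)`. -/
def partialSums {N : ℕ} (c : Composition N) : Set ℕ :=
  {s | ∃ j, 1 ≤ j ∧ j ≤ c.length ∧ s = c.sizeUpTo j}

/-- The central components of the meander: for each common partial sum `s` of `a` and `b`, the
subgraph induced by the vertices after the preceding common partial sum (if any) and up to `s`.
The vertex `v_i` of the usual numbering from `1` is the element `i - 1` of `Fin N`. -/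
def centralComponents {N : ℕ} (a b : Composition N) :
    Set (Graph (Fin N) (Sym2 (Fin N) ⊕ Sym2 (Fin N))) :=
  {H | ∃ s ∈ partialSums a ∩ partialSums b, H = (meander a b).induce
    {i | (i : ℕ) + 1 ≤ s ∧ ∀ r ∈ partialSums a ∩ partialSums b, r < s → r < (i : ℕ) + 1}}

end

/-! The positions of the seaweed algebra form a preorder `S`. A nilpotent ideal contains no
eigenvector, with nonzero eigenvalue, of the adjoint action of one of its elements. This excludes
matrix units at positions reversible in `S` and forces diagonals to be constant along `S`. So the
nilradical consists of the matrices supported on the strict part of `S` plus the diagonals constant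
along `S` (`mem_lieNilradical_iff`); for trace zero the same description holds inside `sl`.

If `W` is a commutative subspace of a Lie algebra `n`, then `W` is isotropic for every form `F ⁅·,
·⁆`, whence `2 dim W ≤ ind n + dim n` (`finrank_le_lieIndex`). Take for `W` the diagonals constant
along `S` together with the matrix units at a set `T` of strict positions, no two of which compose.
The diagonals contribute one dimension per common partial sum, hence at least `|Cen|`, and passing
to trace zero costs at most one dimension. It remains to find `T` that exceeds its complement in the
strict part by `|E₁|` (`exists_isotropic_positions`).

Call the nonempty intersections of a top block with a bottom block cells. Strict positions are the
pairs lying in a common block but in different cells. Cut each block in two at a cell boundary and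
let `T` consist of the pairs separated by the cut of their block. The cut goes next to the cell that
contains the midpoint of the block, at the end of that cell nearer to the midpoint. Then in each
block the separated pairs outnumber the unseparated ones by at least the number of arcs by which the
block and its cells differ (`exists_cut`). Comparing top arcs with cell arcs, and cell arcs with
bottom arcs, bounds `|E₁|` by the triangle inequality `arcDiff_triangle`. -/

/-! ### Matrices supported on a preorder -/

section PreorderMatrices

variable {ι : Type*}

/-- A square matrix whose nonzero entries strictly increase a rank function is nilpotent. -/
theorem Matrix.isNilpotent_of_rank_lt [Fintype ι] [DecidableEq ι] {R : Type*} [CommRing R] (M : Matrix ι ι R) (h : ι → ℕ)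
    (hM : ∀ p q, M p q ≠ 0 → h p < h q) : IsNilpotent M := by
  have key : ∀ k : ℕ, ∀ p q, (M ^ k) p q ≠ 0 → h p + k ≤ h q := by
    intro k
    induction k with
    | zero =>
      intro p q hpq
      rw [pow_zero, Matrix.one_apply] at hpq
      split_ifs at hpq with hh
      · simp [hh]
      · exact absurd rfl hpq
    | succ k ih =>
      intro p q hpq
      rw [pow_succ, Matrix.mul_apply] at hpq
      obtain ⟨r, -, hr⟩ := Finset.exists_ne_zero_of_sum_ne_zero hpq
      have h1 := ih p r (left_ne_zero_of_mul hr)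
      have h2 := hM r q (right_ne_zero_of_mul hr)
      omega
  refine ⟨Finset.univ.sup h + 1, ?_⟩
  ext p q
  by_contra hne
  have h1 := key _ p q hne
  have h2 : h q ≤ Finset.univ.sup h := Finset.le_sup (Finset.mem_univ q)
  omega

/-- The matrices supported on a relation. -/
def relSpan (S : ι → ι → Prop) : Submodule ℂ (Matrix ι ι ℂ) where
  carrier := {X | ∀ p q, ¬ S p q → X p q = 0}
  add_mem' := by
    intro X Y hX hY p q h
    simp [hX p q h, hY p q h]
  zero_mem' := by simp
  smul_mem' := by
    intro c X hX p q h
    simp [hX p q h]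

theorem single_mem_relSpan [DecidableEq ι] {S : ι → ι → Prop} {p q : ι} (h : S p q) (c : ℂ) :
    Matrix.single p q c ∈ relSpan S := by
  intro i j hij
  rw [Matrix.single_apply, if_neg]
  rintro ⟨rfl, rfl⟩
  exact hij h

theorem mul_mem_relSpan [Fintype ι] {S T U : ι → ι → Prop} (h : ∀ p q r, S p q → T q r → U p r)
    {X Y : Matrix ι ι ℂ} (hX : X ∈ relSpan S) (hY : Y ∈ relSpan T) : X * Y ∈ relSpan U := by
  intro p q hpq
  rw [Matrix.mul_apply]
  refine Finset.sum_eq_zero fun r _ => ?_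
  by_cases h1 : S p r
  · rw [hY r q fun h2 => hpq (h p r q h1 h2), mul_zero]
  · rw [hX p r h1, zero_mul]

/-- The strict part of a relation. -/
def strictPart (S : ι → ι → Prop) (p q : ι) : Prop := S p q ∧ ¬ S q p

/-- The span of the matrix units at off-diagonal positions in `T` and of the diagonal matrices
that are constant along `S`. -/
def diagAddSpan (S T : ι → ι → Prop) : Submodule ℂ (Matrix ι ι ℂ) where
  carrier := {X | (∀ p q, p ≠ q → ¬ T p q → X p q = 0) ∧ ∀ p q, S p q → X p p = X q q}
  add_mem' := by
    rintro X Y ⟨hX, hX'⟩ ⟨hY, hY'⟩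
    refine ⟨fun p q h h' => by simp [hX p q h h', hY p q h h'], fun p q h => ?_⟩
    simp [hX' p q h, hY' p q h]
  zero_mem' := by simp
  smul_mem' := by
    rintro c X ⟨hX, hX'⟩
    refine ⟨fun p q h h' => by simp [hX p q h h'], fun p q h => ?_⟩
    simp [hX' p q h]

theorem sub_diagonal_mem_relSpan [DecidableEq ι] {S T : ι → ι → Prop} {X : Matrix ι ι ℂ}
    (hX : X ∈ diagAddSpan S T) : X - Matrix.diagonal X.diag ∈ relSpan T := by
  intro p q hpq
  rw [Matrix.sub_apply, Matrix.diagonal_apply]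
  split_ifs with h
  · subst h; simp
  · simp [hX.1 p q h hpq]

theorem commute_diagonal [Fintype ι] [DecidableEq ι] {S T : ι → ι → Prop} {X Y : Matrix ι ι ℂ}
    (hX : X ∈ diagAddSpan S T) (hY : Y ∈ relSpan S) : Commute (Matrix.diagonal X.diag) Y := by
  ext p q
  rw [Matrix.diagonal_mul, Matrix.mul_diagonal]
  by_cases h : S p q
  · rw [Matrix.diag_apply, Matrix.diag_apply, hX.2 p q h, mul_comm]
  · rw [hY p q h, mul_zero, zero_mul]

theorem lie_eq_lie_sub_diagonal [Fintype ι] [DecidableEq ι] {S T : ι → ι → Prop} {X Y : Matrix ι ι ℂ}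
    (hX : X ∈ diagAddSpan S T) (hY : Y ∈ relSpan S) :
    ⁅X, Y⁆ = ⁅X - Matrix.diagonal X.diag, Y⁆ := by
  have h := commute_diagonal hX hY
  rw [sub_lie, (commute_iff_lie_eq.1 h), sub_zero]

theorem relSpan_le_diagAddSpan {S T : ι → ι → Prop} (hT : ∀ p, ¬ T p p) :
    relSpan T ≤ diagAddSpan S T := by
  intro X hX
  refine ⟨fun p q _ h => hX p q h, fun p q _ => ?_⟩
  rw [hX p p (hT p), hX q q (hT q)]

theorem not_strictPart_self (S : ι → ι → Prop) (p : ι) : ¬ strictPart S p p :=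
  fun h => h.2 h.1

theorem diagAddSpan_le_relSpan {S T : ι → ι → Prop} (hr : ∀ p, S p p) (hT : ∀ p q, T p q → S p q) :
    diagAddSpan S T ≤ relSpan S := by
  intro X hX p q hpq
  refine hX.1 p q ?_ fun h => hpq (hT p q h)
  rintro rfl
  exact hpq (hr p)

/-- The diagonal part of `X` commutes with `Y`, and by transitivity a strict position composed with
any position of `S` is strict again. -/
theorem lie_mem_diagAddSpan_strictPart [Fintype ι] [DecidableEq ι] {S : ι → ι → Prop}
    (ht : ∀ p q r, S p q → S q r → S p r) {X Y : Matrix ι ι ℂ}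
    (hX : X ∈ diagAddSpan S (strictPart S)) (hY : Y ∈ relSpan S) :
    ⁅X, Y⁆ ∈ diagAddSpan S (strictPart S) := by
  rw [lie_eq_lie_sub_diagonal hX hY, Ring.lie_def]
  have hX0 := sub_diagonal_mem_relSpan hX
  refine relSpan_le_diagAddSpan (not_strictPart_self S) (Submodule.sub_mem _
    (mul_mem_relSpan ?_ hX0 hY) (mul_mem_relSpan ?_ hY hX0))
  · exact fun p q r h1 h2 => ⟨ht _ _ _ h1.1 h2, fun h => h1.2 (ht _ _ _ h2 h)⟩
  · exact fun p q r h1 h2 => ⟨ht _ _ _ h1 h2.1, fun h => h2.2 (ht _ _ _ h h1)⟩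

theorem isNilpotent_of_mem_relSpan_strictPart [Fintype ι] [DecidableEq ι] {S : ι → ι → Prop}
    (ht : ∀ p q r, S p q → S q r → S p r) {X : Matrix ι ι ℂ}
    (hX : X ∈ relSpan (strictPart S)) : IsNilpotent X := by
  classical
  -- The number of strict predecessors increases along the strict part.
  refine Matrix.isNilpotent_of_rank_lt X (fun p => (Finset.univ.filter fun r => strictPart S r p).card) fun p q hpq => ?_
  have h : strictPart S p q := by
    by_contra h
    exact hpq (hX p q h)
  refine Finset.card_lt_card (Finset.ssubset_iff_of_subset ?_ |>.2 ⟨p, ?_, ?_⟩)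
  · intro r hr
    simp only [Finset.mem_filter, Finset.mem_univ, true_and] at hr ⊢
    exact ⟨ht _ _ _ hr.1 h.1, fun h' => hr.2 (ht _ _ _ h.1 h')⟩
  · simpa using h
  · simpa using not_strictPart_self S p

theorem lie_diagonal_apply [Fintype ι] [DecidableEq ι] (d : ι → ℂ) (X : Matrix ι ι ℂ) (i j : ι) :
    ⁅Matrix.diagonal d, X⁆ i j = (d i - d j) * X i j := by
  rw [Ring.lie_def, Matrix.sub_apply, Matrix.diagonal_mul, Matrix.mul_diagonal]
  ring

/-- A space of matrices that is stable under brackets with `relSpan S` and has no bracket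
eigenvectors with nonzero eigenvalue consists of a strict part and a central diagonal part. -/
theorem le_diagAddSpan_of_lie_mem [Fintype ι] [DecidableEq ι] {S : ι → ι → Prop} (hr : ∀ p, S p p)
    {P : Submodule ℂ (Matrix ι ι ℂ)} (hP : P ≤ relSpan S)
    (hlie : ∀ X ∈ P, ∀ Y ∈ relSpan S, ⁅X, Y⁆ ∈ P)
    (heig : ∀ X ∈ P, ∀ Y ∈ P, ∀ c : ℂ, c ≠ 0 → ⁅X, Y⁆ = c • Y → Y = 0) :
    P ≤ diagAddSpan S (strictPart S) := by
  have hlie' : ∀ X ∈ P, ∀ Y ∈ relSpan S, ⁅Y, X⁆ ∈ P := fun X hX Y hY => by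
    rw [← lie_skew]; exact P.neg_mem (hlie X hX Y hY)
  have hcomp : ∀ X ∈ P, ∀ p q, p ≠ q → Matrix.single p q (X p q) ∈ P := by
    intro X hX p q hpq
    -- `h1` keeps only the entries of `X` at `(p, q)` and `(q, p)`, and `h2` changes the sign of the
    -- second one. Half their sum isolates the entry at `(p, q)`.
    have h1 := hlie' _ (hlie X hX _ (single_mem_relSpan (hr q) 1)) _ (single_mem_relSpan (hr p) 1)
    have h2 := hlie' _ h1 _ (single_mem_relSpan (hr p) 1)
    have h3 := P.smul_mem (2⁻¹ : ℂ) (P.add_mem h1 h2)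
    convert h3 using 1
    rw [← lie_skew X]
    simp only [← Matrix.diagonal_single]
    ext i j
    simp only [Matrix.smul_apply, Matrix.add_apply, Matrix.neg_apply, lie_diagonal_apply, lie_neg,
      Pi.single_apply, smul_eq_mul, Matrix.single_apply, eq_comm (a := p) (b := i),
      eq_comm (a := q) (b := j)]
    clear h1 h2 h3 heig hlie hlie' hX hP hr
    have hqp := hpq.symm
    by_cases hip : i = p <;> by_cases hjp : j = p <;> by_cases hiq : i = q <;>
      by_cases hjq : j = q <;> simp_all
    ring
  have hone : ∀ X ∈ P, ∀ p q, p ≠ q → X p q ≠ 0 → Matrix.single p q 1 ∈ P := by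
    intro X hX p q hpq h0
    have := P.smul_mem (X p q)⁻¹ (hcomp X hX p q hpq)
    simpa [h0] using this
  have hne : ∀ p q : ι, Matrix.single p q (1 : ℂ) ≠ 0 := fun p q h => by
    have := congrFun (congrFun h p) q
    simp at this
  have hstrict : ∀ p q, p ≠ q → Matrix.single p q 1 ∈ P → strictPart S p q := by
    intro p q hpq h
    have hS : S p q := by
      by_contra h'
      have := hP h p q h'
      simp at this
    refine ⟨hS, fun h' => ?_⟩
    -- If `(p, q)` were reversible, `⁅E_{p,q}, E_{q,p}⁆` would lie in `P` and have `E_{p,q}` as an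
    -- eigenvector with eigenvalue 2, as in `sl₂`.
    refine hne p q (heig _ (hlie _ h _ (single_mem_relSpan h' 1)) _ h 2 two_ne_zero ?_)
    simp only [Ring.lie_def, Matrix.single_mul_single_same, mul_one, mul_sub, sub_mul,
      Matrix.single_mul_single_of_ne _ _ _ _ hpq.symm]
    simp [two_smul]
  intro X hX
  refine ⟨fun p q hpq h => ?_, fun p q h => ?_⟩
  · by_contra h0
    exact h (hstrict p q hpq (hone X hX p q hpq h0))
  · by_contra h0
    have hpq : p ≠ q := by rintro rfl; exact h0 rfl
    have hD : Matrix.diagonal X.diag ∈ P := by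
      have : Matrix.diagonal X.diag =
          X - ∑ i, ∑ j, if i = j then 0 else Matrix.single i j (X i j) := by
        ext i j
        simp only [Matrix.sub_apply, Matrix.sum_apply, Matrix.diagonal_apply, Matrix.diag_apply]
        rw [Finset.sum_eq_single i, Finset.sum_eq_single j]
        · split_ifs with hij <;> simp [hij]
        · intro j' _ hj'
          split_ifs <;> simp [hj']
        · simp
        · intro i' _ hi'
          refine Finset.sum_eq_zero fun j' _ => ?_
          split_ifs <;> simp [hi']
        · simp
      rw [this]
      refine P.sub_mem hX (P.sum_mem fun i _ => P.sum_mem fun j _ => ?_)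
      split_ifs with hij
      · exact P.zero_mem
      · exact hcomp X hX i j hij
    -- Unequal diagonal entries at `p` and `q` would make `E_{p,q}` an eigenvector with nonzero
    -- eigenvalue, and bracketing with `D` would put it into `P`.
    have hDE : ⁅Matrix.diagonal X.diag, Matrix.single p q (1 : ℂ)⁆ =
        (X p p - X q q) • Matrix.single p q (1 : ℂ) := by
      ext i j
      rw [lie_diagonal_apply]
      by_cases hij : p = i ∧ q = j
      · obtain ⟨rfl, rfl⟩ := hij
        simp
      · simp [hij]
    have hE : Matrix.single p q (1 : ℂ) ∈ P := by
      have := P.smul_mem (X p p - X q q)⁻¹ (hlie _ hD _ (single_mem_relSpan h 1))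
      rwa [hDE, smul_smul, inv_mul_cancel₀ (sub_ne_zero.2 h0), one_smul] at this
    exact hne p q (heig _ hD _ hE _ (sub_ne_zero.2 h0) hDE)

end PreorderMatrices

/-! ### The nilradical -/

section Nilradical

variable {ι : Type*} [Fintype ι] [DecidableEq ι] {L : Type*} [LieRing L] [LieAlgebra ℂ L]

/-- The ideal of elements represented by a strict part plus a central diagonal part. -/
def strictIdeal {S : ι → ι → Prop} (ht : ∀ p q r, S p q → S q r → S p r)
    (φ : L →ₗ⁅ℂ⁆ Matrix ι ι ℂ) (hS : ∀ x, φ x ∈ relSpan S) : LieIdeal ℂ L where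
  toSubmodule := (diagAddSpan S (strictPart S)).comap (φ : L →ₗ[ℂ] Matrix ι ι ℂ)
  lie_mem := by
    intro x m hm
    change φ ⁅x, m⁆ ∈ diagAddSpan S (strictPart S)
    rw [← lie_skew, map_neg, LieHom.map_lie]
    exact Submodule.neg_mem _ (lie_mem_diagAddSpan_strictPart ht hm (hS x))

theorem mem_strictIdeal {S : ι → ι → Prop} (ht : ∀ p q r, S p q → S q r → S p r)
    (φ : L →ₗ⁅ℂ⁆ Matrix ι ι ℂ) (hS : ∀ x, φ x ∈ relSpan S) {x : L} :
    x ∈ strictIdeal ht φ hS ↔ φ x ∈ diagAddSpan S (strictPart S) := Iff.rfl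

/-- By Engel's theorem it suffices that each `ad x` is nilpotent. The central diagonal part of `φ x`
does not contribute, so `ad x` is induced by the bracket with a nilpotent matrix. -/
theorem isNilpotent_strictIdeal [FiniteDimensional ℂ L] {S : ι → ι → Prop}
    (ht : ∀ p q r, S p q → S q r → S p r) {φ : L →ₗ⁅ℂ⁆ Matrix ι ι ℂ}
    (hφ : Function.Injective φ) (hS : ∀ x, φ x ∈ relSpan S) :
    LieRing.IsNilpotent (strictIdeal ht φ hS) := by
  rw [LieAlgebra.isNilpotent_iff_forall (R := ℂ)]
  intro x
  have hx : φ x ∈ diagAddSpan S (strictPart S) := x.2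
  set X := φ x - Matrix.diagonal (φ x).diag with hX
  have hX0 : X ∈ relSpan (strictPart S) := sub_diagonal_mem_relSpan hx
  obtain ⟨k, hk⟩ := LieAlgebra.ad_nilpotent_of_nilpotent (R := ℂ)
    (isNilpotent_of_mem_relSpan_strictPart ht hX0)
  have key : ∀ (k : ℕ) (y : strictIdeal ht φ hS),
      φ (((LieAlgebra.ad ℂ (strictIdeal ht φ hS) x ^ k) y : strictIdeal ht φ hS) : L) =
        (LieAlgebra.ad ℂ (Matrix ι ι ℂ) X ^ k) (φ y) := by
    intro k y
    induction k with
    | zero => simp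
    | succ k ih =>
      rw [pow_succ', pow_succ', Module.End.mul_apply, Module.End.mul_apply, ← ih,
        LieAlgebra.ad_apply, LieAlgebra.ad_apply]
      change φ ⁅(x : L), (((LieAlgebra.ad ℂ (strictIdeal ht φ hS) x ^ k) y :
        strictIdeal ht φ hS) : L)⁆ = _
      rw [LieHom.map_lie, lie_eq_lie_sub_diagonal hx (hS _)]
  refine ⟨k, LinearMap.ext fun y => Subtype.ext (hφ ?_)⟩
  rw [key, hk]
  simp

/-- The image of `I` satisfies the hypotheses of `le_diagAddSpan_of_lie_mem`: `ad x` is nilpotent on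
`I`, so its only eigenvalue is 0. Surjectivity is needed only up to scalar matrices, which do not
affect brackets; this covers the trace-zero case. -/
theorem le_strictIdeal_of_isNilpotent {S : ι → ι → Prop} (hr : ∀ p, S p p)
    (ht : ∀ p q r, S p q → S q r → S p r) {φ : L →ₗ⁅ℂ⁆ Matrix ι ι ℂ}
    (hφ : Function.Injective φ) (hS : ∀ x, φ x ∈ relSpan S)
    (hsurj : ∀ X ∈ relSpan S, ∃ x, ∃ c : ℂ, φ x = X + c • 1)
    (I : LieIdeal ℂ L) (hI : LieRing.IsNilpotent I) : I ≤ strictIdeal ht φ hS := by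
  intro x hx
  rw [mem_strictIdeal]
  refine le_diagAddSpan_of_lie_mem hr (P := I.toSubmodule.map (φ : L →ₗ[ℂ] Matrix ι ι ℂ))
    ?_ ?_ ?_ ⟨x, hx, rfl⟩
  · rintro _ ⟨x, -, rfl⟩
    exact hS x
  · rintro _ ⟨x, hx, rfl⟩ Y hY
    obtain ⟨y, c, hy⟩ := hsurj Y hY
    refine ⟨⁅x, y⁆, lie_mem_left ℂ L I x y hx, ?_⟩
    have h1 : ⁅φ x, c • (1 : Matrix ι ι ℂ)⁆ = 0 := by
      rw [Ring.lie_def]; simp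
    change φ ⁅x, y⁆ = ⁅φ x, Y⁆
    rw [LieHom.map_lie, hy, lie_add, h1, add_zero]
  · rintro _ ⟨x, hx, rfl⟩ _ ⟨y, hy, rfl⟩ c hc hxy
    replace hxy : ⁅x, y⁆ = c • y := hφ (by
      rw [LieHom.map_lie, map_smul]
      exact hxy)
    obtain ⟨k, hk⟩ := LieAlgebra.nilpotent_ad_of_nilpotent_algebra ℂ I
    have h1 : ∀ k : ℕ, (LieAlgebra.ad ℂ I ⟨x, hx⟩ ^ k) ⟨y, hy⟩ = c ^ k • (⟨y, hy⟩ : I) := by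
      intro k
      induction k with
      | zero => simp
      | succ k ih =>
        rw [pow_succ', Module.End.mul_apply, ih, map_smul, pow_succ, mul_smul]
        congr 1
        exact Subtype.ext hxy
    have h2 := h1 k
    rw [hk, LinearMap.zero_apply, eq_comm, smul_eq_zero_iff_right (pow_ne_zero k hc)] at h2
    have h3 : y = 0 := congrArg Subtype.val h2
    change φ y = 0
    rw [h3, map_zero]

theorem mem_lieNilradical_iff [FiniteDimensional ℂ L] {S : ι → ι → Prop} (hr : ∀ p, S p p)
    (ht : ∀ p q r, S p q → S q r → S p r) {φ : L →ₗ⁅ℂ⁆ Matrix ι ι ℂ}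
    (hφ : Function.Injective φ) (hS : ∀ x, φ x ∈ relSpan S)
    (hsurj : ∀ X ∈ relSpan S, ∃ x, ∃ c : ℂ, φ x = X + c • 1) {x : L} :
    x ∈ lieNilradical ℂ L ↔ φ x ∈ diagAddSpan S (strictPart S) := by
  have h : lieNilradical ℂ L = strictIdeal ht φ hS :=
    le_antisymm (sSup_le fun I hI => le_strictIdeal_of_isNilpotent hr ht hφ hS hsurj I hI)
      (le_sSup (isNilpotent_strictIdeal ht hφ hS))
  rw [h, mem_strictIdeal]

end Nilradical

/-! ### Isotropic subspaces and the index -/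

section Index

/-- `B` maps `W` into the annihilator of `W`, of dimension `dim V - dim W`, with kernel at most `ker
B`. -/
theorem finrank_add_finrank_le_of_isotropic {K V : Type*} [Field K] [AddCommGroup V] [Module K V]
    [FiniteDimensional K V] (B : V →ₗ[K] Module.Dual K V) (W : Submodule K V)
    (hW : ∀ x ∈ W, ∀ y ∈ W, B x y = 0) :
    Module.finrank K W + Module.finrank K W ≤
      Module.finrank K (LinearMap.ker B) + Module.finrank K V := by
  have h1 := (B.domRestrict W).finrank_range_add_finrank_ker
  have h2 : Module.finrank K (LinearMap.range (B.domRestrict W)) ≤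
      Module.finrank K W.dualAnnihilator := by
    apply Submodule.finrank_mono
    rintro _ ⟨x, rfl⟩
    rw [Submodule.mem_dualAnnihilator]
    exact fun y hy => hW x x.2 y hy
  have h3 := Subspace.finrank_add_finrank_dualAnnihilator_eq W
  have h4 : Module.finrank K (LinearMap.ker (B.domRestrict W)) ≤
      Module.finrank K (LinearMap.ker B) := by
    rw [(Submodule.equivMapOfInjective W.subtype W.injective_subtype _).finrank_eq]
    apply Submodule.finrank_mono
    rintro _ ⟨x, hx, rfl⟩
    exact hx
  omega

theorem finrank_le_lieIndex {K L : Type*} [Field K] [LieRing L] [LieAlgebra K L]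
    [FiniteDimensional K L] (W : Submodule K L) (hW : ∀ x ∈ W, ∀ y ∈ W, ⁅x, y⁆ = 0) :
    Module.finrank K W + Module.finrank K W ≤ lieIndex K L + Module.finrank K L := by
  obtain ⟨F, hF⟩ : lieIndex K L ∈ {d | ∃ F : Module.Dual K L, d = Module.finrank K
    (LinearMap.ker ((LieModule.toEnd K L L : L →ₗ[K] Module.End K L).compr₂ F))} :=
      Nat.sInf_mem ⟨_, 0, rfl⟩
  rw [hF]
  refine finrank_add_finrank_le_of_isotropic _ W fun x hx y hy => ?_
  change F ⁅x, y⁆ = 0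
  rw [hW x hx y hy, map_zero]

end Index

/-! ### Commutative subspaces of the nilradical -/

section NilradicalIndex

variable {ι : Type*} [Fintype ι] [DecidableEq ι] {L : Type*} [LieRing L] [LieAlgebra ℂ L]

/-- The diagonal parts commute with everything in sight, and the remaining parts have zero products
because no two positions of `T` compose. -/
theorem lie_eq_zero_of_mem_diagAddSpan {S T : ι → ι → Prop} (hr : ∀ p, S p p)
    (hTS : ∀ p q, T p q → strictPart S p q) (hT : ∀ p q r, T p q → T q r → False)
    {X Y : Matrix ι ι ℂ} (hX : X ∈ diagAddSpan S T) (hY : Y ∈ diagAddSpan S T) : ⁅X, Y⁆ = 0 := by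
  have hle := diagAddSpan_le_relSpan (T := T) hr fun p q h => (hTS p q h).1
  have hirr : ∀ p, ¬ T p p := fun p h => (hTS p p h).2 (hTS p p h).1
  have hX0 := sub_diagonal_mem_relSpan hX
  have hY0 := sub_diagonal_mem_relSpan hY
  rw [lie_eq_lie_sub_diagonal hX (hle hY), ← lie_skew,
    lie_eq_lie_sub_diagonal hY (hle (relSpan_le_diagAddSpan hirr hX0)), neg_eq_zero, Ring.lie_def]
  have hmul : ∀ Z W : Matrix ι ι ℂ, Z ∈ relSpan T → W ∈ relSpan T → Z * W = 0 := by
    intro Z W hZ hW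
    ext p q
    exact mul_mem_relSpan (U := fun _ _ => False) (fun p q r => hT p q r) hZ hW p q id
  rw [hmul _ _ hX0 hY0, hmul _ _ hY0 hX0, sub_zero]

/-- The elements of the nilradical represented by a matrix of `diagAddSpan S T`. -/
noncomputable def nilradicalPart (φ : L →ₗ⁅ℂ⁆ Matrix ι ι ℂ) (S T : ι → ι → Prop) :
    Submodule ℂ (lieNilradical ℂ L) :=
  (diagAddSpan S T).comap ((φ : L →ₗ[ℂ] Matrix ι ι ℂ) ∘ₗ (lieNilradical ℂ L).toSubmodule.subtype)

/-- The commutative subspace is cut out of the nilradical by the vanishing of the entries at strict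
positions outside `T`, so their number bounds its codimension. -/
theorem finrank_nilradicalPart_le [FiniteDimensional ℂ L] {S T : ι → ι → Prop} (hr : ∀ p, S p p)
    (ht : ∀ p q r, S p q → S q r → S p r) {φ : L →ₗ⁅ℂ⁆ Matrix ι ι ℂ}
    (hφ : Function.Injective φ) (hS : ∀ x, φ x ∈ relSpan S)
    (hsurj : ∀ X ∈ relSpan S, ∃ x, ∃ c : ℂ, φ x = X + c • 1)
    (hTS : ∀ p q, T p q → strictPart S p q) (hT : ∀ p q r, T p q → T q r → False) :
    Module.finrank ℂ (nilradicalPart φ S T) ≤ lieIndex ℂ (lieNilradical ℂ L) +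
      Nat.card {e : ι × ι // strictPart S e.1 e.2 ∧ ¬ T e.1 e.2} := by
  classical
  have h1 := finrank_le_lieIndex (nilradicalPart φ S T) fun x hx y hy => by
    apply Subtype.ext
    apply hφ
    change φ ⁅(x : L), (y : L)⁆ = φ 0
    rw [LieHom.map_lie, map_zero]
    exact lie_eq_zero_of_mem_diagAddSpan hr hTS hT hx hy
  let f : lieNilradical ℂ L →ₗ[ℂ] ({e : ι × ι // strictPart S e.1 e.2 ∧ ¬ T e.1 e.2} → ℂ) :=
    { toFun := fun x e => φ x e.1.1 e.1.2
      map_add' := fun x y => by ext; simp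
      map_smul' := fun c x => by ext; simp }
  have h2 := f.finrank_range_add_finrank_ker
  have h3 : Module.finrank ℂ (LinearMap.range f) ≤
      Nat.card {e : ι × ι // strictPart S e.1 e.2 ∧ ¬ T e.1 e.2} := by
    refine (Submodule.finrank_le _).trans ?_
    rw [Module.finrank_fintype_fun_eq_card, Nat.card_eq_fintype_card]
  have h4 : Module.finrank ℂ (LinearMap.ker f) ≤ Module.finrank ℂ (nilradicalPart φ S T) := by
    apply Submodule.finrank_mono
    intro x hx
    have hx' := (mem_lieNilradical_iff hr ht hφ hS hsurj).1 x.2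
    refine ⟨fun p q hpq h => ?_, hx'.2⟩
    by_cases hpq' : strictPart S p q
    · exact congrFun (LinearMap.mem_ker.1 hx) ⟨(p, q), hpq', h⟩
    · exact hx'.1 p q hpq hpq'
  omega

theorem finrank_diagAddSpan_le_of_surjective [FiniteDimensional ℂ L] {S T : ι → ι → Prop}
    (hr : ∀ p, S p p) (ht : ∀ p q r, S p q → S q r → S p r) {φ : L →ₗ⁅ℂ⁆ Matrix ι ι ℂ}
    (hφ : Function.Injective φ) (hS : ∀ x, φ x ∈ relSpan S)
    (hsurj : ∀ X ∈ relSpan S, ∃ x, φ x = X) (hTS : ∀ p q, T p q → strictPart S p q) :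
    Module.finrank ℂ (diagAddSpan S T) ≤ Module.finrank ℂ (nilradicalPart φ S T) := by
  refine le_trans ?_ (Submodule.finrank_map_le
    ((φ : L →ₗ[ℂ] Matrix ι ι ℂ) ∘ₗ (lieNilradical ℂ L).toSubmodule.subtype) _)
  apply Submodule.finrank_mono
  intro X hX
  obtain ⟨x, rfl⟩ := hsurj X (diagAddSpan_le_relSpan hr (fun p q h => (hTS p q h).1) hX)
  refine ⟨⟨x, (mem_lieNilradical_iff hr ht hφ hS ?_).2 ?_⟩, hX, rfl⟩
  · intro X hX
    obtain ⟨x, hx⟩ := hsurj X hX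
    exact ⟨x, 0, by simpa using hx⟩
  · exact ⟨fun p q h h' => hX.1 p q h fun h'' => h' (hTS p q h''), hX.2⟩

/-- Every matrix of `diagAddSpan S T` is represented up to a scalar matrix, which accounts for the
one lost dimension. -/
theorem finrank_diagAddSpan_le_add_one [FiniteDimensional ℂ L] {S T : ι → ι → Prop}
    (hr : ∀ p, S p p) (ht : ∀ p q r, S p q → S q r → S p r) {φ : L →ₗ⁅ℂ⁆ Matrix ι ι ℂ}
    (hφ : Function.Injective φ) (hS : ∀ x, φ x ∈ relSpan S)
    (hsurj : ∀ X ∈ relSpan S, ∃ x, ∃ c : ℂ, φ x = X + c • 1)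
    (hTS : ∀ p q, T p q → strictPart S p q) :
    Module.finrank ℂ (diagAddSpan S T) ≤ Module.finrank ℂ (nilradicalPart φ S T) + 1 := by
  have h1 := Submodule.finrank_map_le ((φ : L →ₗ[ℂ] Matrix ι ι ℂ) ∘ₗ
    (lieNilradical ℂ L).toSubmodule.subtype) (nilradicalPart φ S T)
  have h2 : Module.finrank ℂ (Submodule.span ℂ {(1 : Matrix ι ι ℂ)}) ≤ 1 := by
    simpa using finrank_span_le_card (R := ℂ) {(1 : Matrix ι ι ℂ)}
  refine le_trans ?_ ((Submodule.finrank_add_le_finrank_add_finrank _ _).trans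
    (Nat.add_le_add h1 h2))
  apply Submodule.finrank_mono
  intro X hX
  obtain ⟨x, c, hx⟩ := hsurj X (diagAddSpan_le_relSpan hr (fun p q h => (hTS p q h).1) hX)
  have hX' : X = φ x + (-c) • 1 := by rw [hx]; simp
  have h1T : (1 : Matrix ι ι ℂ) ∈ diagAddSpan S T :=
    ⟨fun p q h _ => Matrix.one_apply_ne h, fun p q _ => by simp⟩
  have hxT : φ x ∈ diagAddSpan S T := by
    rw [hx]
    exact Submodule.add_mem _ hX (Submodule.smul_mem _ c h1T)
  rw [hX']
  refine Submodule.add_mem_sup ⟨⟨x, (mem_lieNilradical_iff hr ht hφ hS hsurj).2 ?_⟩, hxT, rfl⟩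
    (Submodule.smul_mem _ _ (Submodule.mem_span_singleton_self 1))
  exact ⟨fun p q h h' => hxT.1 p q h fun h'' => h' (hTS p q h''), hxT.2⟩

/-- The entries at `T` can be chosen freely, and so can one diagonal value for each element of `κ`.
-/
theorem card_add_card_le_finrank_diagAddSpan {κ : Type*} [Finite κ] {S T : ι → ι → Prop}
    (hT : ∀ p, ¬ T p p) (g : ι → κ) (hg : Function.Surjective g)
    (hgS : ∀ p q, S p q → g p = g q) :
    Nat.card {e : ι × ι // T e.1 e.2} + Nat.card κ ≤ Module.finrank ℂ (diagAddSpan S T) := by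
  classical
  have := Fintype.ofFinite κ
  let M : ({e : ι × ι // T e.1 e.2} → ℂ) × (κ → ℂ) → Matrix ι ι ℂ := fun x =>
    Matrix.of fun p q => if p = q then x.2 (g p) else if h : T p q then x.1 ⟨(p, q), h⟩ else 0
  let f : ({e : ι × ι // T e.1 e.2} → ℂ) × (κ → ℂ) →ₗ[ℂ] diagAddSpan S T :=
    { toFun := fun x => ⟨M x, fun p q h h' => by simp [M, h, h'], fun p q h => by
        simp [M, hgS p q h]⟩
      map_add' := fun x y => by
        ext p q
        simp only [M, Submodule.coe_add, Matrix.add_apply, Matrix.of_apply]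
        split_ifs <;> simp
      map_smul' := fun c x => by
        ext p q
        simp only [M, Submodule.coe_smul, Matrix.smul_apply, Matrix.of_apply, RingHom.id_apply]
        split_ifs <;> simp }
  have hf : Function.Injective f := by
    rintro ⟨x, d⟩ ⟨x', d'⟩ h
    have h' : ∀ p q, M (x, d) p q = M (x', d') p q := fun p q =>
      congrFun (congrFun (congrArg Subtype.val h) p) q
    simp only [M, Matrix.of_apply] at h'
    refine Prod.ext (funext ?_) (funext ?_)
    · rintro ⟨⟨p, q⟩, hpq⟩
      have hne : p ≠ q := by rintro rfl; exact hT p hpq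
      have := h' p q
      simpa [hne, show T p q from hpq] using this
    · intro k
      obtain ⟨p, rfl⟩ := hg k
      simpa using h' p p
  have h1 := LinearMap.finrank_le_finrank_of_injective hf
  rw [Module.finrank_prod, Module.finrank_fintype_fun_eq_card,
    Module.finrank_fintype_fun_eq_card] at h1
  rwa [Nat.card_eq_fintype_card, Nat.card_eq_fintype_card]

end NilradicalIndex

/-! ### Arcs and cuts of a single block -/

section IntervalPartition

/-- `s p` and `e p` are the start and the end of the block `[s p, e p)` containing `p`, for a
partition of `[x, y)` into intervals. -/
structure IsIntervalPartition (x y : ℕ) (s e : ℕ → ℕ) : Prop where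
  le_start : ∀ p, x ≤ p → p < y → x ≤ s p
  start_le : ∀ p, x ≤ p → p < y → s p ≤ p
  lt_end : ∀ p, x ≤ p → p < y → p < e p
  end_le : ∀ p, x ≤ p → p < y → e p ≤ y
  start_eq : ∀ p q, x ≤ p → p < y → s p ≤ q → q < e p → s q = s p
  end_eq : ∀ p q, x ≤ p → p < y → s p ≤ q → q < e p → e q = e p

theorem IsIntervalPartition.sum_le_sum {N : ℕ} {s e : ℕ → ℕ} (h : IsIntervalPartition 0 N s e)
    {f g : ℕ → ℕ} (hfg : ∀ p < N, ∑ q ∈ Finset.Ico (s p) (e p), f q ≤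
      ∑ q ∈ Finset.Ico (s p) (e p), g q) :
    ∑ q ∈ Finset.range N, f q ≤ ∑ q ∈ Finset.range N, g q := by
  -- The condition `s n = n` says that `n` is a block boundary; the induction goes from `n` back to
  -- the start of the block ending there.
  have key : ∀ n ≤ N, (n < N → s n = n) →
      ∑ q ∈ Finset.range n, f q ≤ ∑ q ∈ Finset.range n, g q := by
    intro n
    induction n using Nat.strong_induction_on with
    | _ n ih =>
      intro hn hs
      rcases Nat.eq_zero_or_pos n with rfl | hpos
      · simp
      have hp : n - 1 < N := by omega
      have h1 := h.start_le (n - 1) (Nat.zero_le _) hp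
      have h2 := h.lt_end (n - 1) (Nat.zero_le _) hp
      have h3 := h.end_le (n - 1) (Nat.zero_le _) hp
      have he : e (n - 1) = n := by
        by_contra hne
        have h4 := h.start_eq (n - 1) n (Nat.zero_le _) hp (by omega) (by omega)
        have := hs (by omega)
        omega
      have hss := h.start_eq (n - 1) (s (n - 1)) (Nat.zero_le _) hp le_rfl (by omega)
      have h5 := ih (s (n - 1)) (by omega) (by omega) fun _ => hss
      have h6 := hfg (n - 1) hp
      rw [he] at h6
      rw [← Finset.sum_range_add_sum_Ico f (show s (n - 1) ≤ n by omega),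
        ← Finset.sum_range_add_sum_Ico g (show s (n - 1) ≤ n by omega)]
      exact Nat.add_le_add h5 h6
  exact key N le_rfl fun h => absurd h (lt_irrefl _)

/-- The number of arcs with lower endpoint `p` that belong to exactly one of the two arc systems
of the intervals `[s, e)` and `[s', e')`. -/
def arcDiff (s e s' e' p : ℕ) : ℕ :=
  if s + e = s' + e' then 0
  else (if 2 * p + 1 < s + e then 1 else 0) + (if 2 * p + 1 < s' + e' then 1 else 0)

theorem arcDiff_comm (s e s' e' p : ℕ) : arcDiff s e s' e' p = arcDiff s' e' s e p := by
  unfold arcDiff; split_ifs <;> omega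

theorem arcDiff_triangle (s e s' e' s'' e'' p : ℕ) :
    arcDiff s e s'' e'' p ≤ arcDiff s e s' e' p + arcDiff s' e' s'' e'' p := by
  unfold arcDiff; split_ifs <;> omega

theorem two_mul_sum_Ico_sub (s e : ℕ) (h : s ≤ e) :
    2 * ∑ p ∈ Finset.Ico s e, ((e : ℤ) - p - 1) = ((e : ℤ) - s) * (e - s - 1) := by
  induction e, h using Nat.le_induction with
  | base => simp
  | succ e h ih =>
    have h1 : ∀ p ∈ Finset.Ico s e, ((e + 1 : ℕ) : ℤ) - p - 1 = ((e : ℤ) - p - 1) + 1 := by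
      intro p _; push_cast; ring
    rw [Finset.sum_Ico_succ_top h, Finset.sum_congr rfl h1, Finset.sum_add_distrib]
    simp only [Finset.sum_const, Nat.card_Ico, nsmul_eq_mul, mul_one]
    rw [mul_add, mul_add, ih]
    push_cast [Nat.cast_sub h]
    ring

theorem sum_lower_half (s e : ℕ) :
    ∑ p ∈ Finset.Ico s e, (if 2 * p + 1 < s + e then (1 : ℤ) else 0) = ((e - s) / 2 : ℕ) := by
  rw [Finset.sum_boole]
  have : (Finset.Ico s e).filter (fun p => 2 * p + 1 < s + e) =
      Finset.Ico s (s + (e - s) / 2) := by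
    ext p
    simp only [Finset.mem_filter, Finset.mem_Ico]
    omega
  rw [this, Nat.card_Ico]
  simp

theorem arcDiff_le (s e s' e' p : ℕ) : (arcDiff s e s' e' p : ℤ) ≤
    (if 2 * p + 1 < s + e then 1 else 0) + (if 2 * p + 1 < s' + e' then 1 else 0) := by
  unfold arcDiff; split_ifs <;> simp

/-- If `[u, v)` is the cell of the midpoint of `[s, e)`, cutting `[s, e)` at the end of the cell
that is closer to the midpoint satisfies the numerical inequality below. -/
theorem cut_inequality {s e u v k : ℕ} (hsu : s ≤ u) (huv : u < v) (hve : v ≤ e)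
    (hne : s + e ≠ u + v) (h1 : 2 * u ≤ s + e) (h2 : s + e ≤ 2 * v)
    (hk : k = if u + v ≤ s + e then v else u) :
    (2 * ((e - s) / 2 : ℕ) + 2 * ((v - u) / 2 : ℕ) : ℤ) - ((v : ℤ) - u) * (v - u - 1) +
      ((k : ℤ) - s) * (k - s - 1) + ((e : ℤ) - k) * (e - k - 1) ≤
      2 * (((k : ℤ) - s) * (e - k)) := by
  -- `d` is the difference of the two sides of the cut
  obtain ⟨d, hd, hdm, hd2⟩ : ∃ d : ℕ, ((2 * k : ℤ) - s - e) ^ 2 = (d : ℤ) ^ 2 ∧ d + 1 ≤ v - u ∧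
      d % 2 = (e - s) % 2 := by
    split_ifs at hk
    · refine ⟨2 * v - (s + e), ?_, by omega, by omega⟩
      rw [hk, Nat.cast_sub h2]; push_cast; ring
    · refine ⟨s + e - 2 * u, ?_, by omega, by omega⟩
      rw [hk, Nat.cast_sub h1]; push_cast; ring
  clear hk
  obtain ⟨a, i, hi, hn⟩ : ∃ a i : ℕ, i < 2 ∧ e - s = 2 * a + i :=
    ⟨(e - s) / 2, (e - s) % 2, by omega, by omega⟩
  obtain ⟨b, j, hj, hm⟩ : ∃ b j : ℕ, j < 2 ∧ v - u = 2 * b + j :=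
    ⟨(v - u) / 2, (v - u) % 2, by omega, by omega⟩
  obtain ⟨f, hf⟩ : ∃ f, d = 2 * f + i := ⟨d / 2, by omega⟩
  have ha : (e - s) / 2 = a := by omega
  have hb : (v - u) / 2 = b := by omega
  have hez : (e : ℤ) = s + 2 * a + i := by omega
  have hvz : (v : ℤ) = u + 2 * b + j := by omega
  have hfz : (d : ℤ) = 2 * f + i := by omega
  -- With `n = e - s` and `m = v - u`, the claim reduces to `d² ≤ (m - 1)² - 1 + i + j`, where `i`,
  -- `j` are the parities of `n`, `m`. Since `d ≤ m - 1` and `d ≡ n` mod 2, equal parities improve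
  -- this to `d ≤ m - 2`.
  have key : (d : ℤ) ^ 2 + 2 * (2 * b + j) - (2 * b + j) ^ 2 - i - j ≤ 0 := by
    have hfb : (2 * f + i + 1 : ℤ) ≤ 2 * b + j := by omega
    rw [hfz]
    interval_cases i <;> interval_cases j <;> push_cast at hfb ⊢
    · have h3 : (f : ℤ) ^ 2 ≤ (b - 1) ^ 2 := pow_le_pow_left₀ (by omega) (by omega) 2
      have h4 : (1 : ℤ) ≤ b := by omega
      linarith
    · have h3 : (f : ℤ) ^ 2 ≤ b ^ 2 := pow_le_pow_left₀ (by omega) (by omega) 2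
      linarith
    · have h3 : ((f : ℤ) + 1) * f ≤ b * (b - 1) :=
        mul_le_mul (by omega) (by omega) (by omega) (by omega)
      linarith
    · have h3 : ((f : ℤ) + 1) * f ≤ b * b :=
        mul_le_mul (by omega) (by omega) (by omega) (by omega)
      linarith
  rw [ha, hb, hvz]
  rw [hez] at hd ⊢
  linarith

/-- No cell straddles `k`, so the unseparated pairs are all pairs within the two parts minus the
pairs within cells. Outside the central cell the pairs within a cell outnumber its arcs, so only the
central cell and the arcs of the block itself need an estimate. -/
theorem exists_cut {s e : ℕ} (hse : s < e) {sc ec : ℕ → ℕ} (h : IsIntervalPartition s e sc ec) :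
    ∃ k, s ≤ k ∧ k ≤ e ∧ (∀ p, s ≤ p → p < k → ec p ≤ k) ∧
      ∑ p ∈ Finset.Ico s e, arcDiff s e (sc p) (ec p) p +
        (∑ p ∈ Finset.Ico s k, (k - ec p) + ∑ p ∈ Finset.Ico k e, (e - ec p)) ≤
      (k - s) * (e - k) := by
  obtain ⟨c, hc⟩ : ∃ c, c = (s + e) / 2 := ⟨_, rfl⟩
  obtain ⟨u, hu⟩ : ∃ u, u = sc c := ⟨_, rfl⟩
  obtain ⟨v, hv⟩ : ∃ v, v = ec c := ⟨_, rfl⟩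
  have hsc : s ≤ c := by omega
  have hce : c < e := by omega
  have hsu : s ≤ u := hu ▸ h.le_start c hsc hce
  have huc : u ≤ c := hu ▸ h.start_le c hsc hce
  have hcv : c < v := hv ▸ h.lt_end c hsc hce
  have hve : v ≤ e := hv ▸ h.end_le c hsc hce
  have hcell : ∀ p, u ≤ p → p < v → sc p = u ∧ ec p = v := by
    intro p h1 h2
    rw [hu] at h1 ⊢; rw [hv] at h2 ⊢
    exact ⟨h.start_eq c p hsc hce h1 h2, h.end_eq c p hsc hce h1 h2⟩
  have hcutu : ∀ p, s ≤ p → p < u → ec p ≤ u := by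
    intro p h1 h2
    by_contra h3
    push Not at h3
    have h4 := h.start_eq p u h1 (by omega) ((h.start_le p h1 (by omega)).trans h2.le) h3
    have h5 := (hcell u le_rfl (by omega)).1
    have := h.start_le p h1 (by omega)
    omega
  have hcutv : ∀ p, s ≤ p → p < v → ec p ≤ v := by
    intro p h1 h2
    by_cases h3 : p < u
    · exact (hcutu p h1 h3).trans (by omega)
    · exact (hcell p (by omega) h2).2.le
  obtain ⟨k, hk⟩ : ∃ k, k = if u + v ≤ s + e then v else u := ⟨_, rfl⟩
  have hsk : s ≤ k := by split_ifs at hk <;> omega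
  have hke : k ≤ e := by split_ifs at hk <;> omega
  have hcut : ∀ p, s ≤ p → p < k → ec p ≤ k := by
    split_ifs at hk
    · rw [hk]; exact hcutv
    · rw [hk]; exact hcutu
  refine ⟨k, hsk, hke, hcut, ?_⟩
  -- `w p` counts the vertices after `p` in its cell.
  obtain ⟨w, hw⟩ : ∃ w : ℕ → ℤ, ∀ p, w p = (ec p : ℤ) - p - 1 := ⟨_, fun _ => rfl⟩
  have hCw : ∀ p, s ≤ p → p < e →
      -- A lower endpoint of an arc has a later vertex in its cell.
      (if 2 * p + 1 < sc p + ec p then (1 : ℤ) else 0) ≤ w p := by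
    intro p h1 h2
    have := h.start_le p h1 h2
    have := h.lt_end p h1 h2
    rw [hw]
    split_ifs <;> omega
  have hS1 : ((∑ p ∈ Finset.Ico s k, (k - ec p) : ℕ) : ℤ) =
      ∑ p ∈ Finset.Ico s k, ((k : ℤ) - p - 1) - ∑ p ∈ Finset.Ico s k, w p := by
    rw [← Finset.sum_sub_distrib, Nat.cast_sum]
    refine Finset.sum_congr rfl fun p hp => ?_
    rw [Finset.mem_Ico] at hp
    rw [Nat.cast_sub (hcut p hp.1 hp.2), hw]
    ring
  have hS2 : ((∑ p ∈ Finset.Ico k e, (e - ec p) : ℕ) : ℤ) =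
      ∑ p ∈ Finset.Ico k e, ((e : ℤ) - p - 1) - ∑ p ∈ Finset.Ico k e, w p := by
    rw [← Finset.sum_sub_distrib, Nat.cast_sum]
    refine Finset.sum_congr rfl fun p hp => ?_
    rw [Finset.mem_Ico] at hp
    rw [Nat.cast_sub (h.end_le p (by omega) hp.2), hw]
    ring
  have hW := Finset.sum_Ico_consecutive w hsk hke
  have hG1 := two_mul_sum_Ico_sub s k hsk
  have hG2 := two_mul_sum_Ico_sub k e hke
  have hcellw : 2 * ∑ p ∈ Finset.Ico u v, w p = ((v : ℤ) - u) * (v - u - 1) := by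
    rw [← two_mul_sum_Ico_sub u v (by omega)]
    congr 1
    refine Finset.sum_congr rfl fun p hp => ?_
    rw [Finset.mem_Ico] at hp
    rw [hw, (hcell p hp.1 hp.2).2]
  have hmain : 2 * (∑ p ∈ Finset.Ico s e, (arcDiff s e (sc p) (ec p) p : ℤ) -
      ∑ p ∈ Finset.Ico s e, w p) +
      ((k : ℤ) - s) * (k - s - 1) + ((e : ℤ) - k) * (e - k - 1) ≤
      2 * (((k : ℤ) - s) * (e - k)) := by
    have hsplit : ∀ f : ℕ → ℤ, ∑ p ∈ Finset.Ico s e, f p = ∑ p ∈ Finset.Ico s u, f p +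
        ∑ p ∈ Finset.Ico u v, f p + ∑ p ∈ Finset.Ico v e, f p := fun f => by
      rw [Finset.sum_Ico_consecutive f hsu (by omega), Finset.sum_Ico_consecutive f (by omega) hve]
    -- If the central cell is concentric with the block, its arcs are arcs of the block and drop
    -- out. Each vertex to its left then carries at most one block arc, and vertices to its right
    -- are lower endpoints of none.
    by_cases hconc : s + e = u + v
    · have hb : ∑ p ∈ Finset.Ico s e, (arcDiff s e (sc p) (ec p) p : ℤ) -
          ∑ p ∈ Finset.Ico s e, w p ≤ ((u : ℤ) - s) - ∑ p ∈ Finset.Ico u v, w p := by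
        rw [← Finset.sum_sub_distrib, hsplit]
        have hb1 : ∑ p ∈ Finset.Ico s u, ((arcDiff s e (sc p) (ec p) p : ℤ) - w p) ≤
            (u : ℤ) - s := by
          refine (Finset.sum_le_card_nsmul _ _ 1 fun p hp => ?_).trans ?_
          · rw [Finset.mem_Ico] at hp
            have h1 := arcDiff_le s e (sc p) (ec p) p
            have h2 := hCw p hp.1 (by omega)
            have h3 : (if 2 * p + 1 < s + e then (1 : ℤ) else 0) ≤ 1 := by split_ifs <;> simp
            linarith
          · simp [Nat.cast_sub hsu]
        have hb2 : ∑ p ∈ Finset.Ico u v, ((arcDiff s e (sc p) (ec p) p : ℤ) - w p) =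
            - ∑ p ∈ Finset.Ico u v, w p := by
          rw [← Finset.sum_neg_distrib]
          refine Finset.sum_congr rfl fun p hp => ?_
          rw [Finset.mem_Ico] at hp
          obtain ⟨h1, h2⟩ := hcell p hp.1 hp.2
          rw [arcDiff, h1, h2, if_pos hconc]
          simp
        have hb3 : ∑ p ∈ Finset.Ico v e, ((arcDiff s e (sc p) (ec p) p : ℤ) - w p) ≤ 0 := by
          refine Finset.sum_nonpos fun p hp => ?_
          rw [Finset.mem_Ico] at hp
          have h1 := arcDiff_le s e (sc p) (ec p) p
          have h2 := hCw p (by omega) hp.2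
          rw [if_neg (by omega)] at h1
          linarith
        linarith
      have hkv : k = v := by rw [hk, if_pos hconc.ge]
      have hcz : (s : ℤ) + e = u + v := by exact_mod_cast hconc
      have hez : (e : ℤ) = u + v - s := by linarith
      subst hkv
      nlinarith
    -- Otherwise the arcs of the block and of the central cell are simply added up.
    · have hb : ∑ p ∈ Finset.Ico s e, (arcDiff s e (sc p) (ec p) p : ℤ) -
          ∑ p ∈ Finset.Ico s e, w p ≤
          ((e - s) / 2 : ℕ) + ((v - u) / 2 : ℕ) - ∑ p ∈ Finset.Ico u v, w p := by
        rw [← sum_lower_half s e, ← sum_lower_half u v]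
        have hb0 : ∑ p ∈ Finset.Ico s e, (arcDiff s e (sc p) (ec p) p : ℤ) ≤
            ∑ p ∈ Finset.Ico s e, (if 2 * p + 1 < s + e then (1 : ℤ) else 0) +
            ∑ p ∈ Finset.Ico s e, (if 2 * p + 1 < sc p + ec p then (1 : ℤ) else 0) := by
          rw [← Finset.sum_add_distrib]
          exact Finset.sum_le_sum fun p _ => arcDiff_le _ _ _ _ _
        have hb1 : ∑ p ∈ Finset.Ico s u, (if 2 * p + 1 < sc p + ec p then (1 : ℤ) else 0) ≤
            ∑ p ∈ Finset.Ico s u, w p := Finset.sum_le_sum fun p hp => by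
          rw [Finset.mem_Ico] at hp
          exact hCw p hp.1 (by omega)
        have hb3 : ∑ p ∈ Finset.Ico v e, (if 2 * p + 1 < sc p + ec p then (1 : ℤ) else 0) ≤
            ∑ p ∈ Finset.Ico v e, w p := Finset.sum_le_sum fun p hp => by
          rw [Finset.mem_Ico] at hp
          exact hCw p (by omega) hp.2
        have hb2 : ∑ p ∈ Finset.Ico u v, (if 2 * p + 1 < sc p + ec p then (1 : ℤ) else 0) =
            ∑ p ∈ Finset.Ico u v, (if 2 * p + 1 < u + v then (1 : ℤ) else 0) :=
          Finset.sum_congr rfl fun p hp => by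
            rw [Finset.mem_Ico] at hp
            obtain ⟨h1, h2⟩ := hcell p hp.1 hp.2
            rw [h1, h2]
        rw [hsplit fun p => if 2 * p + 1 < sc p + ec p then (1 : ℤ) else 0] at hb0
        rw [hsplit w]
        linarith
      have := cut_inequality hsu (huc.trans_lt hcv) hve hconc (by omega) (by omega) hk
      linarith
  zify [hsk, hke]
  push_cast at hS1 hS2
  linarith

end IntervalPartition

/-! ### Cuts of all blocks -/

section Cuts

theorem IsIntervalPartition.inf_block {N : ℕ} {s e s' e' : ℕ → ℕ}
    (h : IsIntervalPartition 0 N s e) (h' : IsIntervalPartition 0 N s' e') {x : ℕ} (hx : x < N) :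
    IsIntervalPartition (s x) (e x) (fun p => max (s p) (s' p)) (fun p => min (e p) (e' p)) := by
  have hex := h.end_le x (Nat.zero_le _) hx
  have hs := h.start_eq x
  have he := h.end_eq x
  constructor
  · intro p h1 h2
    have := hs p (Nat.zero_le _) hx h1 h2
    omega
  · intro p h1 h2
    have := h.start_le p (Nat.zero_le _) (by omega)
    have := h'.start_le p (Nat.zero_le _) (by omega)
    omega
  · intro p h1 h2
    have := h.lt_end p (Nat.zero_le _) (by omega)
    have := h'.lt_end p (Nat.zero_le _) (by omega)
    omega
  · intro p h1 h2
    have := he p (Nat.zero_le _) hx h1 h2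
    omega
  · intro p q h1 h2 h3 h4
    have h5 := h.start_eq p q (Nat.zero_le _) (by omega) (by omega) (by omega)
    have h6 := h'.start_eq p q (Nat.zero_le _) (by omega) (by omega) (by omega)
    simp only [h5, h6]
  · intro p q h1 h2 h3 h4
    have h5 := h.end_eq p q (Nat.zero_le _) (by omega) (by omega) (by omega)
    have h6 := h'.end_eq p q (Nat.zero_le _) (by omega) (by omega) (by omega)
    simp only [h5, h6]

/-- A choice of a cut `k p` in every block `[s p, e p)`, at a boundary of a cell. -/
structure IsCut (N : ℕ) (s e ec k : ℕ → ℕ) : Prop where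
  start_le : ∀ p < N, s p ≤ k p
  le_end : ∀ p < N, k p ≤ e p
  eq : ∀ p q, p < N → s p ≤ q → q < e p → k q = k p
  cell_le : ∀ p < N, p < k p → ec p ≤ k p

/-- The pairs `p < q` in a common block that are separated by its cut. -/
def crossingPairs (N : ℕ) (e k : ℕ → ℕ) : Finset (Σ _ : ℕ, ℕ) :=
  (Finset.range N).sigma fun p => if p < k p then Finset.Ico (k p) (e p) else ∅

/-- The pairs `p < q` in a common block, but not in a common cell, that are not separated by the
cut of the block. -/
def noncrossingPairs (N : ℕ) (e ec k : ℕ → ℕ) : Finset (Σ _ : ℕ, ℕ) :=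
  (Finset.range N).sigma fun p =>
    if p < k p then Finset.Ico (ec p) (k p) else Finset.Ico (ec p) (e p)

theorem mem_crossingPairs {N : ℕ} {e k : ℕ → ℕ} {p q : ℕ} :
    (⟨p, q⟩ : Σ _ : ℕ, ℕ) ∈ crossingPairs N e k ↔ p < N ∧ p < k p ∧ k p ≤ q ∧ q < e p := by
  simp only [crossingPairs, Finset.mem_sigma, Finset.mem_range]
  split_ifs with h <;> simp [h]

theorem mem_noncrossingPairs {N : ℕ} {e ec k : ℕ → ℕ} {p q : ℕ} :
    (⟨p, q⟩ : Σ _ : ℕ, ℕ) ∈ noncrossingPairs N e ec k ↔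
      p < N ∧ ec p ≤ q ∧ ((p < k p ∧ q < k p) ∨ (k p ≤ p ∧ q < e p)) := by
  simp only [noncrossingPairs, Finset.mem_sigma, Finset.mem_range]
  split_ifs with h
  · simp [h]
  · simp [h]; omega

theorem exists_isCut {N : ℕ} {s e s' e' : ℕ → ℕ} (h : IsIntervalPartition 0 N s e)
    (h' : IsIntervalPartition 0 N s' e') :
    ∃ k, IsCut N s e (fun p => min (e p) (e' p)) k ∧
      ∑ p ∈ Finset.range N, arcDiff (s p) (e p) (max (s p) (s' p)) (min (e p) (e' p)) p +
        (noncrossingPairs N e (fun p => min (e p) (e' p)) k).card ≤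
      (crossingPairs N e k).card := by
  have hex : ∀ x, ∃ k, x < N → s x ≤ k ∧ k ≤ e x ∧
      (∀ p, s x ≤ p → p < k → min (e p) (e' p) ≤ k) ∧
      ∑ p ∈ Finset.Ico (s x) (e x),
        arcDiff (s x) (e x) (max (s p) (s' p)) (min (e p) (e' p)) p +
        (∑ p ∈ Finset.Ico (s x) k, (k - min (e p) (e' p)) +
          ∑ p ∈ Finset.Ico k (e x), (e x - min (e p) (e' p))) ≤ (k - s x) * (e x - k) := by
    intro x
    by_cases hx : x < N
    · have h1 := h.start_le x (Nat.zero_le _) hx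
      have h2 := h.lt_end x (Nat.zero_le _) hx
      obtain ⟨k, hk⟩ := exists_cut (h1.trans_lt h2) (h.inf_block h' hx)
      exact ⟨k, fun _ => hk⟩
    · exact ⟨0, fun h => absurd h hx⟩
  choose κ hκ using hex
  have hstart : ∀ x < N, s x < N ∧ s (s x) = s x ∧ e (s x) = e x := by
    intro x hx
    have h1 := h.start_le x (Nat.zero_le _) hx
    have h2 := h.lt_end x (Nat.zero_le _) hx
    exact ⟨by omega, h.start_eq x _ (Nat.zero_le _) hx le_rfl (by omega),
      h.end_eq x _ (Nat.zero_le _) hx le_rfl (by omega)⟩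
  -- Evaluating the choice at the start of the block makes the cut constant on blocks.
  obtain ⟨k, hk⟩ : ∃ k : ℕ → ℕ, ∀ p, k p = κ (s p) := ⟨_, fun _ => rfl⟩
  have hkk : ∀ x < N, s x ≤ k x ∧ k x ≤ e x ∧
      (∀ p, s x ≤ p → p < k x → min (e p) (e' p) ≤ k x) ∧
      ∑ p ∈ Finset.Ico (s x) (e x),
        arcDiff (s x) (e x) (max (s p) (s' p)) (min (e p) (e' p)) p +
        (∑ p ∈ Finset.Ico (s x) (k x), (k x - min (e p) (e' p)) +
          ∑ p ∈ Finset.Ico (k x) (e x), (e x - min (e p) (e' p))) ≤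
        (k x - s x) * (e x - k x) := by
    intro x hx
    obtain ⟨h1, h2, h3⟩ := hstart x hx
    have := hκ (s x) h1
    rwa [h2, h3, ← hk] at this
  have hkeq : ∀ p q, p < N → s p ≤ q → q < e p → k q = k p := by
    intro p q hp h1 h2
    rw [hk, hk, h.start_eq p q (Nat.zero_le _) hp h1 h2]
  refine ⟨k, ⟨fun p hp => (hkk p hp).1, fun p hp => (hkk p hp).2.1, hkeq, fun p hp h1 =>
    (hkk p hp).2.2.1 p (h.start_le p (Nat.zero_le _) hp) h1⟩, ?_⟩
  rw [noncrossingPairs, crossingPairs, Finset.card_sigma, Finset.card_sigma,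
    ← Finset.sum_add_distrib]
  apply h.sum_le_sum
  intro x hx
  obtain ⟨h1, h2, -, h3⟩ := hkk x hx
  have hN := h.end_le x (Nat.zero_le _) hx
  have hse : ∀ p ∈ Finset.Ico (s x) (e x), s p = s x ∧ e p = e x ∧ k p = k x := by
    intro p hp
    rw [Finset.mem_Ico] at hp
    exact ⟨h.start_eq x p (Nat.zero_le _) hx hp.1 hp.2, h.end_eq x p (Nat.zero_le _) hx hp.1 hp.2,
      hkeq x p hx hp.1 hp.2⟩
  have hL : Finset.Ico (s x) (k x) ⊆ Finset.Ico (s x) (e x) := Finset.Ico_subset_Ico_right h2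
  have hR : Finset.Ico (k x) (e x) ⊆ Finset.Ico (s x) (e x) := Finset.Ico_subset_Ico_left h1
  rw [Finset.sum_add_distrib]
  refine le_trans (le_of_eq ?_) (h3.trans (le_of_eq ?_))
  · congr 1
    · refine Finset.sum_congr rfl fun p hp => ?_
      rw [(hse p hp).1, (hse p hp).2.1]
    · rw [← Finset.sum_Ico_consecutive _ h1 h2]
      congr 1
      · refine Finset.sum_congr rfl fun p hp => ?_
        rw [(hse p (hL hp)).2.2, if_pos (Finset.mem_Ico.1 hp).2, Nat.card_Ico]
      · refine Finset.sum_congr rfl fun p hp => ?_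
        rw [(hse p (hR hp)).2.2, if_neg (Finset.mem_Ico.1 hp).1.not_gt, Nat.card_Ico,
          (hse p (hR hp)).2.1]
  · rw [← Finset.sum_Ico_consecutive _ h1 h2]
    have h4 : ∀ p ∈ Finset.Ico (s x) (k x),
        (if p < k p then Finset.Ico (k p) (e p) else ∅).card = e x - k x := by
      intro p hp
      rw [(hse p (hL hp)).2.2, if_pos (Finset.mem_Ico.1 hp).2, Nat.card_Ico, (hse p (hL hp)).2.1]
    have h5 : ∀ p ∈ Finset.Ico (k x) (e x),
        (if p < k p then Finset.Ico (k p) (e p) else ∅).card = 0 := by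
      intro p hp
      rw [(hse p (hR hp)).2.2, if_neg (Finset.mem_Ico.1 hp).1.not_gt, Finset.card_empty]
    rw [Finset.sum_congr rfl h4, Finset.sum_congr rfl h5]
    simp

end Cuts

/-! ### Blocks, arcs and strict positions of compositions -/

section Compositions

variable {N : ℕ}

/-- The first position of the block of `p`. -/
def Composition.blockStart (c : Composition N) (p : ℕ) : ℕ :=
  if h : p < N then c.sizeUpTo (c.index ⟨p, h⟩) else 0

/-- The first position after the block of `p`. -/
def Composition.blockEnd (c : Composition N) (p : ℕ) : ℕ :=
  if h : p < N then c.sizeUpTo (c.index ⟨p, h⟩ + 1) else 0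

theorem Composition.blockStart_coe (c : Composition N) (p : Fin N) :
    c.blockStart p = c.sizeUpTo (c.index p) := by
  simp [Composition.blockStart]

theorem Composition.blockEnd_coe (c : Composition N) (p : Fin N) :
    c.blockEnd p = c.sizeUpTo (c.index p + 1) := by
  simp [Composition.blockEnd]

theorem Composition.lt_sizeUpTo_iff (c : Composition N) (p : Fin N) (j : ℕ) :
    (p : ℕ) < c.sizeUpTo j ↔ (c.index p : ℕ) < j := by
  constructor
  · intro h
    by_contra hj
    have h1 := c.monotone_sizeUpTo (not_lt.1 hj)
    have h2 := c.sizeUpTo_index_le p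
    omega
  · intro h
    have h1 := c.monotone_sizeUpTo (Nat.succ_le_of_lt h)
    have h2 := c.lt_sizeUpTo_index_succ p
    exact h2.trans_le h1

theorem Composition.index_eq_iff (c : Composition N) (p q : Fin N) :
    c.index p = c.index q ↔ c.blockStart p ≤ q ∧ (q : ℕ) < c.blockEnd p := by
  rw [c.blockStart_coe, c.blockEnd_coe, c.lt_sizeUpTo_iff, ← not_lt, c.lt_sizeUpTo_iff, Fin.ext_iff]
  omega

theorem Composition.isIntervalPartition (c : Composition N) :
    IsIntervalPartition 0 N c.blockStart c.blockEnd := by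
  have h1 : ∀ p < N, c.blockStart p ≤ p ∧ p < c.blockEnd p ∧ c.blockEnd p ≤ N := by
    intro p hp
    have h := (c.index_eq_iff ⟨p, hp⟩ ⟨p, hp⟩).1 rfl
    refine ⟨h.1, h.2, ?_⟩
    rw [c.blockEnd_coe ⟨p, hp⟩]
    exact c.sizeUpTo_le _
  have h2 : ∀ p q, p < N → c.blockStart p ≤ q → q < c.blockEnd p →
      c.blockStart q = c.blockStart p ∧ c.blockEnd q = c.blockEnd p := by
    intro p q hp h3 h4
    have hq : q < N := h4.trans_le (h1 p hp).2.2
    have h5 := (c.index_eq_iff ⟨p, hp⟩ ⟨q, hq⟩).2 ⟨h3, h4⟩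
    rw [c.blockStart_coe ⟨p, hp⟩, c.blockStart_coe ⟨q, hq⟩, c.blockEnd_coe ⟨p, hp⟩,
      c.blockEnd_coe ⟨q, hq⟩, h5]
    exact ⟨rfl, rfl⟩
  exact ⟨fun p _ _ => Nat.zero_le _, fun p _ hp => (h1 p hp).1, fun p _ hp => (h1 p hp).2.1,
    fun p _ hp => (h1 p hp).2.2, fun p q _ hp h3 h4 => (h2 p q hp h3 h4).1,
    fun p q _ hp h3 h4 => (h2 p q hp h3 h4).2⟩

/-- Arcs join positions exchanged by the reflection of the block `[s, e)`, which is `x ↦ s + e - 1 -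
x`. -/
theorem mem_blockArcs_iff (c : Composition N) {x y : Fin N} (hxy : x < y) :
    s(x, y) ∈ blockArcs c ↔
      (x : ℕ) + y + 1 = c.blockStart x + c.blockEnd x := by
  constructor
  · rintro ⟨k, t, -, h⟩
    have key : ∀ t : Fin (c.blocksFun k), c.blockStart (c.embedding k t) +
        c.blockEnd (c.embedding k t) =
          (c.embedding k t : ℕ) + (c.embedding k t.rev : ℕ) + 1 := by
      intro t
      rw [c.blockStart_coe, c.blockEnd_coe, c.index_embedding, c.coe_embedding, c.coe_embedding,
        c.sizeUpTo_succ', Fin.val_rev]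
      have := t.2
      omega
    rcases Sym2.eq_iff.1 h with ⟨rfl, rfl⟩ | ⟨rfl, rfl⟩
    · rw [key]
    · have := key t.rev
      rw [Fin.rev_rev] at this
      rw [this]
  · intro h
    rw [c.blockStart_coe, c.blockEnd_coe, c.sizeUpTo_succ'] at h
    have h1 := c.embedding_comp_inv x
    have h2 := congrArg Fin.val h1
    rw [c.coe_embedding] at h2
    have h3 : c.embedding (c.index x) (c.invEmbedding x).rev = y := by
      apply Fin.ext
      rw [c.coe_embedding, Fin.val_rev]
      have := (c.invEmbedding x).2
      omega
    refine ⟨c.index x, c.invEmbedding x, ?_, ?_⟩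
    · intro h4
      rw [← h4, h1] at h3
      exact hxy.ne h3
    · rw [h1, h3]

theorem notMem_blockArcs_diag (c : Composition N) (x : Fin N) : s(x, x) ∉ blockArcs c := by
  rintro ⟨k, t, ht, h⟩
  rw [Sym2.eq_iff] at h
  apply ht
  apply (c.embedding k).injective
  rcases h with ⟨h1, h2⟩ | ⟨h1, h2⟩ <;> rw [← h1, ← h2]

/-- A nonparallel edge belongs to only one of the two arc systems, and it is determined by its side
(top or bottom) and its lower endpoint. -/
theorem ncard_nonparallelEdges_le (a b : Composition N) :
    (nonparallelEdges a b).ncard ≤ ∑ p ∈ Finset.range N,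
      arcDiff (a.blockStart p) (a.blockEnd p) (b.blockStart p) (b.blockEnd p) p := by
  let E : Composition N → Finset ℕ := fun c => (Finset.range N).filter fun p =>
    a.blockStart p + a.blockEnd p ≠ b.blockStart p + b.blockEnd p ∧
      2 * p + 1 < c.blockStart p + c.blockEnd p
  have hsum : ∑ p ∈ Finset.range N,
      arcDiff (a.blockStart p) (a.blockEnd p) (b.blockStart p) (b.blockEnd p) p =
      ((E a).disjSum (E b)).card := by
    rw [Finset.card_disjSum, Finset.card_filter, Finset.card_filter, ← Finset.sum_add_distrib]
    refine Finset.sum_congr rfl fun p _ => ?_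
    unfold arcDiff
    split_ifs <;> simp_all
  have hform : ∀ z ∈ nonparallelEdges a b, ∃ x y : Fin N, x < y ∧
      (z = Sum.inl s(x, y) ∧ s(x, y) ∈ blockArcs a ∧ s(x, y) ∉ blockArcs b ∨
        z = Sum.inr s(x, y) ∧ s(x, y) ∉ blockArcs a ∧ s(x, y) ∈ blockArcs b) := by
    rintro z ⟨x, y, hz, huniq⟩
    have h1 : s(x, y) ∈ blockArcs a → z = Sum.inl s(x, y) := fun h =>
      (huniq _ (Or.inl ⟨rfl, h⟩)).symm
    have h2 : s(x, y) ∈ blockArcs b → z = Sum.inr s(x, y) := fun h =>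
      (huniq _ (Or.inr ⟨rfl, h⟩)).symm
    have h3 : z = Sum.inl s(x, y) ∧ s(x, y) ∈ blockArcs a ∧ s(x, y) ∉ blockArcs b ∨
        z = Sum.inr s(x, y) ∧ s(x, y) ∉ blockArcs a ∧ s(x, y) ∈ blockArcs b := by
      rcases hz with ⟨hz, h⟩ | ⟨hz, h⟩
      · exact Or.inl ⟨hz, h, fun h' => by simpa [hz] using h2 h'⟩
      · exact Or.inr ⟨hz, fun h' => by simpa [hz] using h1 h', h⟩
    rcases lt_trichotomy x y with hxy | rfl | hxy
    · exact ⟨x, y, hxy, h3⟩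
    · have := notMem_blockArcs_diag a x
      have := notMem_blockArcs_diag b x
      tauto
    · refine ⟨y, x, hxy, ?_⟩
      rwa [Sym2.eq_swap]
  let low : Sym2 (Fin N) → ℕ := fun z => (z.inf : Fin N)
  have hlow : ∀ {x y : Fin N}, x < y → low s(x, y) = x := fun h => by
    simp [low, Sym2.inf_mk, h.le]
  rw [hsum, ← Set.ncard_coe_finset]
  refine Set.ncard_le_ncard_of_injOn (Sum.map low low) ?_ ?_
  · intro z hz
    obtain ⟨x, y, hxy, ⟨rfl, h1, h2⟩ | ⟨rfl, h1, h2⟩⟩ := hform z hz <;>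
    · rw [mem_blockArcs_iff _ hxy] at h1 h2
      have := x.2
      have : (x : ℕ) < y := hxy
      simp only [Sum.map_inl, Sum.map_inr, hlow hxy, Finset.mem_coe, Finset.inl_mem_disjSum,
        Finset.inr_mem_disjSum, E, Finset.mem_filter, Finset.mem_range]
      omega
  · intro z hz z' hz' heq
    obtain ⟨x, y, hxy, ⟨rfl, h1, h2⟩ | ⟨rfl, h1, h2⟩⟩ := hform z hz <;>
    obtain ⟨x', y', hxy', ⟨rfl, h1', h2'⟩ | ⟨rfl, h1', h2'⟩⟩ := hform z' hz' <;>
    simp only [Sum.map_inl, Sum.map_inr, hlow hxy, hlow hxy', Sum.inl.injEq, Sum.inr.injEq,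
      reduceCtorEq, Fin.val_inj] at heq <;>
    · subst heq
      rw [mem_blockArcs_iff _ hxy] at h1 h2
      rw [mem_blockArcs_iff _ hxy'] at h1' h2'
      have : y = y' := Fin.ext (by omega)
      rw [this]

theorem strictPart_seaweedPos {a b : Composition N} {p q : Fin N}
    (h : strictPart (SeaweedPos a b) p q) :
    (q < p ∧ a.index p = a.index q ∧ b.index p ≠ b.index q) ∨
      (p < q ∧ b.index p = b.index q ∧ a.index p ≠ a.index q) := by
  obtain ⟨h1, h2⟩ := h
  simp only [SeaweedPos, not_or, not_and] at h1 h2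
  rcases h1 with rfl | ⟨h1, h3⟩ | ⟨h1, h3⟩
  · exact absurd rfl h2.1
  · exact Or.inl ⟨h1, h3, fun h => h2.2.2 h1 h.symm⟩
  · exact Or.inr ⟨h1, h3, fun h => h2.2.1 h1 h.symm⟩

theorem strictPart_seaweedPos_of_left {a b : Composition N} {p q : Fin N} (h : q < p)
    (ha : a.index p = a.index q) (hb : b.index p ≠ b.index q) :
    strictPart (SeaweedPos a b) p q := by
  refine ⟨Or.inr (Or.inl ⟨h, ha⟩), ?_⟩
  rintro (h1 | ⟨h1, -⟩ | ⟨-, h1⟩)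
  · exact h.ne h1
  · exact h.asymm h1
  · exact hb h1.symm

theorem strictPart_seaweedPos_of_right {a b : Composition N} {p q : Fin N} (h : p < q)
    (hb : b.index p = b.index q) (ha : a.index p ≠ a.index q) :
    strictPart (SeaweedPos a b) p q := by
  refine ⟨Or.inr (Or.inr ⟨h, hb⟩), ?_⟩
  rintro (h1 | ⟨-, h1⟩ | ⟨h1, -⟩)
  · exact h.ne h1.symm
  · exact ha h1.symm
  · exact h.asymm h1

end Compositions

/-! ### The isotropic set of positions -/

section Counting

variable {N : ℕ}

/-- The cut lies at a cell boundary, so the cell of `p` ends before `q`, while the block of `p` in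
`c` does not. -/
theorem separated_of_crossing {c c' : Composition N} {k : ℕ → ℕ}
    (hk : IsCut N c.blockStart c.blockEnd (fun p => min (c.blockEnd p) (c'.blockEnd p)) k)
    {p q : Fin N} (h : (⟨p, q⟩ : Σ _ : ℕ, ℕ) ∈ crossingPairs N c.blockEnd k) :
    p < q ∧ c.index p = c.index q ∧ c'.index p ≠ c'.index q := by
  obtain ⟨-, h1, h2, h3⟩ := mem_crossingPairs.1 h
  have h4 := c.isIntervalPartition.start_le p (Nat.zero_le _) p.2
  have h5 := hk.cell_le p p.2 h1
  refine ⟨Fin.lt_def.2 (by omega), (c.index_eq_iff p q).2 ⟨by omega, h3⟩, fun h6 => ?_⟩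
  have := ((c'.index_eq_iff p q).1 h6).2
  omega

theorem mem_noncrossing_of_separated {c c' : Composition N} {k : ℕ → ℕ} {p q : Fin N}
    (hpq : p < q) (h : c.index p = c.index q) (h' : c'.index p ≠ c'.index q)
    (hnot : (⟨p, q⟩ : Σ _ : ℕ, ℕ) ∉ crossingPairs N c.blockEnd k) :
    (⟨p, q⟩ : Σ _ : ℕ, ℕ) ∈
      noncrossingPairs N c.blockEnd (fun p => min (c.blockEnd p) (c'.blockEnd p)) k := by
  rw [mem_crossingPairs] at hnot
  rw [mem_noncrossingPairs]
  have h1 := ((c.index_eq_iff p q).1 h).2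
  have h2 := c'.isIntervalPartition.start_le p (Nat.zero_le _) p.2
  have h3 : c'.blockEnd p ≤ q := by
    by_contra h4
    have : (p : ℕ) < q := hpq
    exact h' ((c'.index_eq_iff p q).2 ⟨by omega, by omega⟩)
  have := p.2
  refine ⟨p.2, (min_le_right _ _).trans h3, ?_⟩
  omega

/-- There is a set `T` of positions of the strict part of the seaweed algebra, spanning a space
with zero multiplication, that exceeds its complement by the number of nonparallel edges. -/
theorem exists_isotropic_positions (a b : Composition N) :
    ∃ T : Fin N → Fin N → Prop, (∀ p q, T p q → strictPart (SeaweedPos a b) p q) ∧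
      (∀ p q r, T p q → T q r → False) ∧
      (nonparallelEdges a b).ncard +
        Nat.card {e : Fin N × Fin N // strictPart (SeaweedPos a b) e.1 e.2 ∧ ¬ T e.1 e.2} ≤
        Nat.card {e : Fin N × Fin N // T e.1 e.2} := by
  classical
  obtain ⟨k, hk, hkc⟩ := exists_isCut a.isIntervalPartition b.isIntervalPartition
  obtain ⟨l, hl, hlc⟩ := exists_isCut b.isIntervalPartition a.isIntervalPartition
  -- The finsets store pairs with the smaller entry first, whereas positions coming from `a` lie
  -- below the diagonal; hence the swap.
  refine ⟨fun p q => (⟨q, p⟩ : Σ _ : ℕ, ℕ) ∈ crossingPairs N a.blockEnd k ∨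
    (⟨p, q⟩ : Σ _ : ℕ, ℕ) ∈ crossingPairs N b.blockEnd l, ?_, ?_, ?_⟩
  · rintro p q (h | h)
    · obtain ⟨h1, h2, h3⟩ := separated_of_crossing hk h
      exact strictPart_seaweedPos_of_left h1 h2.symm h3.symm
    · obtain ⟨h1, h2, h3⟩ := separated_of_crossing hl h
      exact strictPart_seaweedPos_of_right h1 h2 h3
  · have hconv : ∀ (c : Composition N) {x y z : Fin N}, x ≤ y → y ≤ z →
        c.index x = c.index z → c.index x = c.index y := fun c x y z h1 h2 h3 =>
      le_antisymm (c.index_mono_aux h1) ((c.index_mono_aux h2).trans h3.ge)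
    rintro p q r (h | h) (h' | h')
    -- Two composable positions from the same composition would put `q` on both sides of the cut of
    -- its block.
    · have h1 := (mem_crossingPairs.1 h).2.1
      obtain ⟨h2, h3, h4, h5⟩ := mem_crossingPairs.1 h'
      have h6 := a.isIntervalPartition.start_le r (Nat.zero_le _) r.2
      have := hk.eq r q r.2 (by omega) h5
      omega
    -- In the mixed cases `p` and `r` lie on the same side of `q`, and the nearer one shares with
    -- `q` a block of both compositions.
    · obtain ⟨h1, h2, h3⟩ := separated_of_crossing hk h
      obtain ⟨h4, h5, h6⟩ := separated_of_crossing hl h'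
      rcases le_total r p with h7 | h7
      · exact h6 (hconv a h4.le h7 h2)
      · exact h3 (hconv b h1.le h7 h5)
    · obtain ⟨h1, h2, h3⟩ := separated_of_crossing hl h
      obtain ⟨h4, h5, h6⟩ := separated_of_crossing hk h'
      rcases le_total r p with h7 | h7
      · have := hconv a h7 h1.le h5
        exact h3 (this.symm.trans h5)
      · have := hconv b h7 h4.le h2
        exact h6 (this.symm.trans h2)
    · have h1 := (mem_crossingPairs.1 h').2.1
      obtain ⟨h2, h3, h4, h5⟩ := mem_crossingPairs.1 h
      have h6 := b.isIntervalPartition.start_le p (Nat.zero_le _) p.2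
      have := hl.eq p q p.2 (by omega) h5
      omega
  · let g : Fin N × Fin N → (Σ _ : ℕ, ℕ) ⊕ (Σ _ : ℕ, ℕ) := fun e =>
      if e.2 < e.1 then Sum.inl ⟨e.2, e.1⟩ else Sum.inr ⟨e.1, e.2⟩
    have hg : Function.Injective g := by
      rintro ⟨p, q⟩ ⟨p', q'⟩ h
      simp only [g] at h
      split_ifs at h <;> simp_all [Fin.val_inj]
    rw [Nat.card_eq_fintype_card, Nat.card_eq_fintype_card, Fintype.card_subtype,
      Fintype.card_subtype]
    have h1 : ((crossingPairs N a.blockEnd k).disjSum (crossingPairs N b.blockEnd l)).card ≤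
        (Finset.univ.filter fun e : Fin N × Fin N =>
          (⟨e.2, e.1⟩ : Σ _ : ℕ, ℕ) ∈ crossingPairs N a.blockEnd k ∨
          (⟨e.1, e.2⟩ : Σ _ : ℕ, ℕ) ∈ crossingPairs N b.blockEnd l).card := by
      refine Finset.card_le_card_of_surjOn g ?_
      rintro (⟨p, q⟩ | ⟨p, q⟩) h
      · rw [Finset.mem_coe, Finset.inl_mem_disjSum] at h
        obtain ⟨h2, h3, h4, h5⟩ := mem_crossingPairs.1 h
        have hq := h5.trans_le (a.isIntervalPartition.end_le p (Nat.zero_le _) h2)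
        refine ⟨(⟨q, hq⟩, ⟨p, h2⟩), by simpa using Or.inl h, ?_⟩
        simp only [g]
        rw [if_pos (Fin.mk_lt_mk.2 (h3.trans_le h4))]
      · rw [Finset.mem_coe, Finset.inr_mem_disjSum] at h
        obtain ⟨h2, h3, h4, h5⟩ := mem_crossingPairs.1 h
        have hq := h5.trans_le (b.isIntervalPartition.end_le p (Nat.zero_le _) h2)
        refine ⟨(⟨p, h2⟩, ⟨q, hq⟩), by simpa using Or.inr h, ?_⟩
        simp only [g]
        rw [if_neg (Fin.mk_lt_mk.not.2 (h3.trans_le h4).not_gt)]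
    have h2 : (Finset.univ.filter fun e : Fin N × Fin N =>
          strictPart (SeaweedPos a b) e.1 e.2 ∧
          ¬ ((⟨e.2, e.1⟩ : Σ _ : ℕ, ℕ) ∈ crossingPairs N a.blockEnd k ∨
            (⟨e.1, e.2⟩ : Σ _ : ℕ, ℕ) ∈ crossingPairs N b.blockEnd l)).card ≤
        ((noncrossingPairs N a.blockEnd (fun p => min (a.blockEnd p) (b.blockEnd p)) k).disjSum
          (noncrossingPairs N b.blockEnd (fun p => min (b.blockEnd p) (a.blockEnd p)) l)).card := by
      refine Finset.card_le_card_of_injOn g ?_ hg.injOn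
      rintro ⟨p, q⟩ h
      simp only [Finset.coe_filter, Finset.mem_univ, true_and, Set.mem_ofPred_eq, not_or] at h
      obtain ⟨h2, h3, h4⟩ := h
      rcases strictPart_seaweedPos h2 with ⟨h5, h6, h7⟩ | ⟨h5, h6, h7⟩
      · simp only [g, if_pos h5, Finset.mem_coe, Finset.inl_mem_disjSum]
        exact mem_noncrossing_of_separated h5 h6.symm h7.symm h3
      · simp only [g, if_neg h5.not_gt, Finset.mem_coe, Finset.inr_mem_disjSum]
        exact mem_noncrossing_of_separated h5 h6 h7 h4
    rw [Finset.card_disjSum] at h1 h2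
    have h3 : (nonparallelEdges a b).ncard ≤
        ∑ p ∈ Finset.range N, arcDiff (a.blockStart p) (a.blockEnd p)
          (max (a.blockStart p) (b.blockStart p)) (min (a.blockEnd p) (b.blockEnd p)) p +
        ∑ p ∈ Finset.range N, arcDiff (b.blockStart p) (b.blockEnd p)
          (max (b.blockStart p) (a.blockStart p)) (min (b.blockEnd p) (a.blockEnd p)) p := by
      -- The arcs of the cells are inserted between those of `a` and those of `b`.
      refine (ncard_nonparallelEdges_le a b).trans ?_
      rw [← Finset.sum_add_distrib]
      refine Finset.sum_le_sum fun p _ => ?_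
      rw [max_comm (b.blockStart p), min_comm (b.blockEnd p), arcDiff_comm (b.blockStart p)]
      exact arcDiff_triangle _ _ _ _ _ _ _
    beta_reduce
    omega

end Counting

/-! ### Common partial sums and central components -/

section Components

variable {N : ℕ}

theorem length_mem_partialSums (hN : 0 < N) (c : Composition N) : N ∈ partialSums c := by
  refine ⟨c.length, ?_, le_rfl, c.sizeUpTo_length.symm⟩
  exact c.length_pos_of_pos hN

/-- A common partial sum is a block boundary of both compositions, so no position of the seaweed
algebra straddles it. -/
theorem SeaweedPos.lt_partialSum_iff {a b : Composition N} {p q : Fin N} (h : SeaweedPos a b p q)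
    {s : ℕ} (hs : s ∈ partialSums a ∩ partialSums b) : (p : ℕ) < s ↔ (q : ℕ) < s := by
  obtain ⟨⟨i, -, -, hi⟩, ⟨j, -, -, hj⟩⟩ := hs
  rcases h with rfl | ⟨-, h⟩ | ⟨-, h⟩
  · rfl
  · rw [hi, a.lt_sizeUpTo_iff, a.lt_sizeUpTo_iff, h]
  · rw [hj, b.lt_sizeUpTo_iff, b.lt_sizeUpTo_iff, h]

theorem partialSums_pos_le {c : Composition N} {s : ℕ} (hs : s ∈ partialSums c) :
    0 < s ∧ s ≤ N := by
  obtain ⟨i, h1, h2, rfl⟩ := hs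
  refine ⟨?_, c.sizeUpTo_le i⟩
  have h3 := c.monotone_sizeUpTo h1
  have h4 : c.sizeUpTo 1 = c.sizeUpTo 0 + _ := c.sizeUpTo_succ (by omega)
  have h5 := c.one_le_blocks' (i := 0) (by omega)
  omega

/-- The smallest common partial sum after `p`. -/
theorem exists_component_map (hN : 0 < N) (a b : Composition N) :
    ∃ g : Fin N → ↥(partialSums a ∩ partialSums b), Function.Surjective g ∧
      ∀ p q, SeaweedPos a b p q → g p = g q := by
  have hne : ∀ p : Fin N, {s | s ∈ partialSums a ∩ partialSums b ∧ (p : ℕ) < s}.Nonempty :=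
    fun p => ⟨N, ⟨length_mem_partialSums hN a, length_mem_partialSums hN b⟩, p.2⟩
  refine ⟨fun p => ⟨_, (Nat.sInf_mem (hne p)).1⟩, ?_, ?_⟩
  · rintro ⟨s, hs⟩
    obtain ⟨h1, h2⟩ := partialSums_pos_le hs.1
    refine ⟨⟨s - 1, by omega⟩, Subtype.ext (le_antisymm (Nat.sInf_le ⟨hs, ?_⟩) ?_)⟩
    · change s - 1 < s
      omega
    · have : s - 1 < _ := (Nat.sInf_mem (hne ⟨s - 1, by omega⟩)).2
      change s ≤ sInf _
      omega
  · intro p q h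
    apply Subtype.ext
    change sInf _ = sInf _
    congr 1
    ext s
    exact and_congr_right fun hs => h.lt_partialSum_iff hs

theorem finite_partialSums_inter (a b : Composition N) :
    (partialSums a ∩ partialSums b).Finite :=
  (Set.finite_Iic N).subset fun _ hs => (partialSums_pos_le hs.1).2

theorem ncard_centralComponents_le (a b : Composition N) :
    (centralComponents a b).ncard ≤ Nat.card ↥(partialSums a ∩ partialSums b) := by
  refine le_trans ?_ (Set.ncard_image_le (finite_partialSums_inter a b)
    (f := fun s => (meander a b).induce {i | (i : ℕ) + 1 ≤ s ∧
      ∀ r ∈ partialSums a ∩ partialSums b, r < s → r < (i : ℕ) + 1}))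
  refine Set.ncard_le_ncard ?_ ((finite_partialSums_inter a b).image _)
  rintro H ⟨s, hs, rfl⟩
  exact ⟨s, hs, rfl⟩

end Components

/-! ### The two index bounds -/

theorem SeaweedPos.refl {N : ℕ} (a b : Composition N) (p : Fin N) : SeaweedPos a b p p :=
  Or.inl rfl

theorem mainTheorem6 (N : ℕ) (hN : 0 < N) (a b : Composition N) :
    (nonparallelEdges a b).ncard + (centralComponents a b).ncard ≤
        lieIndex ℂ (lieNilradical ℂ (seaweed a b)) ∧
      ((nonparallelEdges a b).ncard : ℤ) + (centralComponents a b).ncard - 1 ≤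
        lieIndex ℂ (lieNilradical ℂ (seaweedA a b)) := by
  obtain ⟨T, hTS, hT, hcard⟩ := exists_isotropic_positions a b
  obtain ⟨g, hg, hgS⟩ := exists_component_map hN a b
  have hr := SeaweedPos.refl a b
  have ht : ∀ p q r, SeaweedPos a b p q → SeaweedPos a b q r → SeaweedPos a b p r :=
    fun p q r => SeaweedPos.trans
  have := (finite_partialSums_inter a b).to_subtype
  have hcen := ncard_centralComponents_le a b
  have hdim := card_add_card_le_finrank_diagAddSpan (S := SeaweedPos a b) (T := T)
    (fun p h => hT p p p h h) g hg hgS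
  constructor
  · have hS : ∀ x, (seaweed a b).incl x ∈ relSpan (SeaweedPos a b) := fun x => mem_seaweed.1 x.2
    have hinj : Function.Injective (seaweed a b).incl := Subtype.val_injective
    have hsurj : ∀ X ∈ relSpan (SeaweedPos a b), ∃ x, (seaweed a b).incl x = X :=
      fun X hX => ⟨⟨X, mem_seaweed.2 hX⟩, rfl⟩
    have h1 := finrank_nilradicalPart_le hr ht hinj hS (fun X hX => by
      obtain ⟨x, hx⟩ := hsurj X hX
      exact ⟨x, 0, by simpa using hx⟩) hTS hT
    have h2 := finrank_diagAddSpan_le_of_surjective hr ht hinj hS hsurj hTS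
    omega
  · let φ : seaweedA a b →ₗ⁅ℂ⁆ Matrix (Fin N) (Fin N) ℂ :=
      (LieAlgebra.SpecialLinear.sl (Fin N) ℂ).incl.comp (seaweedA a b).incl
    have hS : ∀ x, φ x ∈ relSpan (SeaweedPos a b) := fun x => mem_seaweed.1 x.2
    have hinj : Function.Injective φ := Subtype.val_injective.comp Subtype.val_injective
    have hsurj : ∀ X ∈ relSpan (SeaweedPos a b), ∃ x, ∃ c : ℂ, φ x = X + c • 1 := by
      intro X hX
      have hN' : (N : ℂ) ≠ 0 := Nat.cast_ne_zero.2 hN.ne'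
      -- Subtracting the scalar matrix with the same trace moves `X` into `sl`; this is where `N ≠
      -- 0` enters.
      have htr : Matrix.trace (X + (-(Matrix.trace X / N)) • (1 : Matrix (Fin N) (Fin N) ℂ)) = 0 := by
        rw [Matrix.trace_add, Matrix.trace_smul, Matrix.trace_one, Fintype.card_fin, smul_eq_mul,
          neg_mul, div_mul_cancel₀ _ hN', add_neg_cancel]
      refine ⟨⟨⟨_, LinearMap.mem_ker.2 htr⟩, mem_seaweed.2 fun p q h => ?_⟩, _, rfl⟩
      have hpq : p ≠ q := by rintro rfl; exact h (hr p)
      simp [hX p q h, hpq]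
    have h1 := finrank_nilradicalPart_le hr ht hinj hS hsurj hTS hT
    have h2 := finrank_diagAddSpan_le_add_one hr ht hinj hS hsurj hTS
    omega
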